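/- Let $K$ be a field of characteristic zero. Write $B_{n,k}(x_1,x_2,\dots)$ for the partial exponential Bell polynomials, defined by $$\frac{1}{k!}\Bigl(\sum_{m\ge1}x_m\frac{t^m}{m!}\Bigr)^k=\sum_{n}B_{n,k}(x_1,x_2,\dots)\frac{t^n}{n!}.$$ Let $\mathcal F=K[a_2,a_3,\dots]$ be the Faà di Bruno Hopf algebra, graded by $\deg a_n=n-1$, with coproduct $\Delta a_n=\sum_{k=1}^n B_{n,k}(a_1,a_2,\dots)\otimes a_k$ (where $a_1=1$) and counit $a_n\mapsto0$ for $n\ge2$. For $n\ge1$ let $\delta_n=\sum_{k=1}^n(-1)^{k-1}(k-1)!\,B_{n,k}(a_2,a_3,\dots)$ be the Connes–Moscovici coordinates. Let $\mathcal F'$ be the graded dual of $\mathcal F$, that is, the linear functionals on $\mathcal F$ that vanish on all but finitely many homogeneous components, with product $\langle b'c',f\rangle=\langle b'\otimes c',\Delta f\rangle$. Let $b'_n=(n+1)!\,a'_{n+1}$ for $n\ge1$, where $\langle a'_n,a_m\rangle=\delta_{n,m}$ (the Kronecker delta) and $a'_n$ vanishes on $1$ and on all products of two or more generators. Let $A$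 be the free Lie algebra over $K$ on generators $X_n$ ($n\ge1$), and give $\mathcal U(A)$ the coproduct for which the $X_n$ are primitive. It has the linear basis $X_{\bar n}=X_{n_1}\cdots X_{n_r}$, indexed by all finite vectors $\bar n=(n_1,\dots,n_r)$ of positive integers, including the empty one. Let $H$ be the shuffle Hopf algebra: its basis is $u^{\bar n}$, dual to $X_{\bar n}$, its product is the shuffle product (counted with multiplicity), and its coproduct is deconcatenation. Let $\rho:\mathcal U(A)\to\mathcal F^*$ be the algebra morphism into the convolution algebra of linear functionals on $\mathcal F$ with $\rho(X_n)=b'_n$. Then: 1. The $\delta_n$, $n\ge1$, are algebraically independent and generate $\mathcal F$. For every $n\ge1$, $$\Delta\delta_n-\delta_n\otimes1-1\otimes\delta_n-\sum_{i=1}^{n-1}\binom{n}{i-1}\,\delta_{n-i}\otimes\delta_i$$ is a linear combination of terms $\delta_{i_1}\cdots\delta_{i_m}\otimes\delta_j$ with $m\ge2$, all indices at least $1$, and $i_1+\dots+i_m+j=n$. That is, the bilinear part of $\Delta\delta_n$ is $B(\delta_n)=\sum_{i=1}^{n-1}\binom{n}{i-1}\delta_{n-i}\otimes\delta_i$. 2.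 The image of $\rho$ is exactly $\mathcal F'$. Moreover $\rho$ is compatible with the coalgebra structures: $\langle\rho(x),fg\rangle=\langle(\rho\otimes\rho)(\Delta x),f\otimes g\rangle$ and $\langle\rho(x),1\rangle=\varepsilon(x)$ for all $x\in\mathcal U(A)$ and $f,g\in\mathcal F$. 3. $\rho$ has a transpose $\rho^t:\mathcal F\to H$, characterised by $\langle\rho^t(f),x\rangle=\langle\rho(x),f\rangle$ for all $f\in\mathcal F$ and $x\in\mathcal U(A)$. It is an injective morphism of Hopf algebras (it respects products, units, coproducts, counits and antipodes), and for every $n\ge1$ $$\rho^t(\delta_n)=\Gamma_n:=n!\sum_{n_1+\dots+n_r=n}C^{\bar n}u^{\bar n},\qquad C^{\bar n}=(n_r+1)\prod_{i=2}^r(n_i+\dots+n_r),$$ where the sum runs over all vectors $\bar n=(n_1,\dots,n_r)$ of positive integers with sum $n$. -/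

import Mathlib

open scoped TensorProduct Nat

noncomputable section

/-! ### Exponential power series and Bell polynomials -/

/-- The exponential power series `∑_{m ≥ 1} x_m t^m / m!` over a commutative `K`-algebra `A`
(the value `x 0` is not used). -/
def expSeries (K : Type*) [Field K] {A : Type*} [CommRing A] [Algebra K A] (x : ℕ → A) :
    PowerSeries A :=
  PowerSeries.mk fun m => if m = 0 then 0 else ((m ! : K)⁻¹) • x m

/-- The partial exponential Bell polynomial `B_{n,k}(x_1, x_2, …)`: the coefficient of
`u^k t^n / n!` in `exp (u ∑_{m ≥ 1} x_m t^m / m!)`, that is, `n!/k!` times the coefficient of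
`t^n` in `(∑_{m ≥ 1} x_m t^m / m!)^k`. -/
def bellPoly (K : Type*) [Field K] {A : Type*} [CommRing A] [Algebra K A] (x : ℕ → A)
    (n k : ℕ) : A :=
  ((n ! : K) * (k ! : K)⁻¹) • PowerSeries.coeff n (expSeries K x ^ k)

section ExpSeries

variable {K : Type*} [Field K] {A B : Type*} [CommRing A] [Algebra K A] [CommRing B] [Algebra K B]

theorem coeff_expSeries (x : ℕ → A) {n : ℕ} (hn : n ≠ 0) :
    PowerSeries.coeff n (expSeries K x) = ((n ! : K)⁻¹) • x n := by
  simp [expSeries, hn]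

theorem constantCoeff_expSeries (x : ℕ → A) :
    PowerSeries.constantCoeff (expSeries K x) = 0 := by
  rw [← PowerSeries.coeff_zero_eq_constantCoeff_apply]; simp [expSeries]

theorem hasSubst_expSeries (x : ℕ → A) : PowerSeries.HasSubst (expSeries K x) :=
  PowerSeries.HasSubst.of_constantCoeff_zero' (constantCoeff_expSeries x)

theorem map_expSeries (f₁ : A →ₐ[K] B) (x : ℕ → A) :
    PowerSeries.map (f₁ : A →+* B) (expSeries K x) = expSeries K (fun n => f₁ (x n)) := by
  ext n
  by_cases hn : n = 0 <;> simp [expSeries, hn]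

theorem map_bellPoly (f₁ : A →ₐ[K] B) (x : ℕ → A) (n k : ℕ) :
    f₁ (bellPoly K x n k) = bellPoly K (fun m => f₁ (x m)) n k := by
  simp only [bellPoly, map_smul]
  rw [← map_expSeries f₁ x, ← map_pow, PowerSeries.coeff_map]
  rfl

/-- Bell polynomials give the coefficients of a composition of exponential series. -/
theorem coeff_subst_expSeries [CharZero K] (x y : ℕ → A) (n : ℕ) :
    PowerSeries.coeff n ((expSeries K y).subst (expSeries K x)) =
      ((n ! : K)⁻¹) • ∑ k ∈ Finset.Icc 1 n, bellPoly K x n k * y k := by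
  rw [PowerSeries.coeff_subst' (hasSubst_expSeries x)]
  have hX : expSeries K x = PowerSeries.X * PowerSeries.mk
      (fun m => PowerSeries.coeff (m + 1) (expSeries K x)) := by
    ext m
    cases m with
    | zero => simp [expSeries]
    | succ m => simp [PowerSeries.coeff_succ_X_mul]
  rw [finsum_eq_sum_of_support_subset (s := Finset.Icc 1 n)]
  · rw [Finset.smul_sum]
    refine Finset.sum_congr rfl fun k hk => ?_
    have hk0 : k ≠ 0 := by have := (Finset.mem_Icc.mp hk).1; omega
    rw [coeff_expSeries y hk0, bellPoly, smul_eq_mul, smul_mul_assoc, smul_mul_assoc, smul_smul,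
      ← mul_assoc, inv_mul_cancel₀ (by exact_mod_cast n.factorial_ne_zero), one_mul, mul_comm]
  · intro k hk
    rw [Function.mem_support] at hk
    simp only [Finset.coe_Icc, Set.mem_Icc]
    constructor
    · by_contra h
      apply hk
      have : k = 0 := by omega
      subst this
      simp [expSeries]
    · by_contra h
      apply hk
      rw [hX, mul_pow, PowerSeries.coeff_X_pow_mul', if_neg h, smul_zero]

end ExpSeries

/-! ### The Faà di Bruno Hopf algebra -/

/-- The polynomial algebra `K[a_2, a_3, …]`; the variable with index `i` is `a_{i+2}`. -/
def FaaDiBruno (K : Type*) [Field K] : Type _ := MvPolynomial ℕ K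

namespace FaaDiBruno

variable (K : Type*) [Field K]

instance : CommRing (FaaDiBruno K) := inferInstanceAs (CommRing (MvPolynomial ℕ K))

instance : Algebra K (FaaDiBruno K) := inferInstanceAs (Algebra K (MvPolynomial ℕ K))

/-- The coordinate `a_n`: a polynomial generator for `n ≥ 2`, with `a_1 = 1` (and the unused
value `a_0 = 0`). -/
def a : ℕ → FaaDiBruno K
  | 0 => 0
  | 1 => 1
  | i + 2 => (MvPolynomial.X i : MvPolynomial ℕ K)

/-- The algebra morphism with `a_{i+2} ↦ f i`. -/
def evalHom {A : Type*} [CommRing A] [Algebra K A] (f : ℕ → A) : FaaDiBruno K →ₐ[K] A :=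
  (MvPolynomial.aeval f : MvPolynomial ℕ K →ₐ[K] A)

variable {K}

@[simp] theorem evalHom_a {A : Type*} [CommRing A] [Algebra K A] (f : ℕ → A) (i : ℕ) :
    evalHom K f (a K (i + 2)) = f i :=
  MvPolynomial.aeval_X f i

theorem algHom_ext' {A : Type*} [CommRing A] [Algebra K A] {f₁ f₂ : FaaDiBruno K →ₐ[K] A}
    (h : ∀ i, f₁ (a K (i + 2)) = f₂ (a K (i + 2))) : f₁ = f₂ :=
  MvPolynomial.algHom_ext (σ := ℕ) (R := K) h

/-- Morphisms `f` are determined by the exponential series `∑ f(a_n) t^n / n!`. -/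
theorem algHom_ext_series [CharZero K] {A : Type*} [CommRing A] [Algebra K A]
    {f₁ f₂ : FaaDiBruno K →ₐ[K] A}
    (h : expSeries K (fun n => f₁ (a K n)) = expSeries K (fun n => f₂ (a K n))) : f₁ = f₂ := by
  refine algHom_ext' fun i => ?_
  have h1 := congrArg (PowerSeries.coeff (i + 2)) h
  rw [coeff_expSeries _ (by omega), coeff_expSeries _ (by omega)] at h1
  have h2 : (((i + 2)! : K)⁻¹) ≠ 0 := inv_ne_zero (by exact_mod_cast (i + 2).factorial_ne_zero)
  simpa [smul_smul, mul_inv_cancel₀, h2, (i + 2).factorial_ne_zero] using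
    congrArg (fun z => ((i + 2)! : K) • z) h1

variable (K) in
/-- The coproduct `Δ a_n = ∑_{k=1}^n B_{n,k}(a_1, a_2, …) ⊗ a_k`. -/
def comulHom : FaaDiBruno K →ₐ[K] FaaDiBruno K ⊗[K] FaaDiBruno K :=
  evalHom K fun i => ∑ k ∈ Finset.Icc 1 (i + 2), bellPoly K (a K) (i + 2) k ⊗ₜ[K] a K k

variable (K) in
/-- The counit: `a_n ↦ 0` for `n ≥ 2`. -/
def counitHom : FaaDiBruno K →ₐ[K] K := evalHom K fun _ => 0

theorem bellPoly_one_one [CharZero K] {A : Type*} [CommRing A] [Algebra K A] (x : ℕ → A) :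
    bellPoly K x 1 1 = x 1 := by
  simp [bellPoly, coeff_expSeries]

/-- The coproduct is dual to the composition of exponential series. -/
theorem series_comul [CharZero K] {A : Type*} [CommRing A] [Algebra K A]
    (f₁ f₂ : FaaDiBruno K →ₐ[K] A) :
    expSeries K (fun n => Algebra.TensorProduct.lift f₁ f₂ (fun _ _ => Commute.all _ _)
        (comulHom K (a K n))) =
      (expSeries K fun n => f₂ (a K n)).subst (expSeries K fun n => f₁ (a K n)) := by
  ext n
  rcases n with _ | n
  · rw [PowerSeries.coeff_zero_eq_constantCoeff_apply, constantCoeff_expSeries,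
      PowerSeries.coeff_zero_eq_constantCoeff_apply]
    exact (PowerSeries.constantCoeff_subst_eq_zero (constantCoeff_expSeries _) _
      (constantCoeff_expSeries _)).symm
  · rw [coeff_subst_expSeries _ _ _, coeff_expSeries _ (by omega)]
    congr 1
    rcases n with _ | i
    · simp [a, bellPoly_one_one]
    · simp [comulHom, map_bellPoly]

/-- `n ↦ f(a_n)` for the unit `f` of convolution gives the series `t`. -/
theorem series_counit [CharZero K] {A : Type*} [CommRing A] [Algebra K A] :
    expSeries K (fun n => algebraMap K A (counitHom K (a K n))) = PowerSeries.X := by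
  ext n
  rcases n with _ | _ | i
  · simp [expSeries]
  · simp [expSeries, a]
  · rw [coeff_expSeries _ (by omega), PowerSeries.coeff_X, if_neg (by omega)]
    simp [counitHom]

open Algebra.TensorProduct in
instance [CharZero K] : Bialgebra K (FaaDiBruno K) :=
  Bialgebra.ofAlgHom (comulHom K) (counitHom K)
    (by
      set j₁ : FaaDiBruno K →ₐ[K] FaaDiBruno K ⊗[K] (FaaDiBruno K ⊗[K] FaaDiBruno K) :=
        includeLeft
      set j₂ : FaaDiBruno K →ₐ[K] FaaDiBruno K ⊗[K] (FaaDiBruno K ⊗[K] FaaDiBruno K) :=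
        includeRight.comp includeLeft
      set j₃ : FaaDiBruno K →ₐ[K] FaaDiBruno K ⊗[K] (FaaDiBruno K ⊗[K] FaaDiBruno K) :=
        includeRight.comp includeRight
      have h1 : ((Algebra.TensorProduct.assoc K K K (FaaDiBruno K) (FaaDiBruno K)
            (FaaDiBruno K)).toAlgHom.comp
            (map (comulHom K) (.id K (FaaDiBruno K)))) =
          lift ((lift j₁ j₂ (fun _ _ => Commute.all _ _)).comp (comulHom K)) j₃
            (fun _ _ => Commute.all _ _) := by
        refine Algebra.TensorProduct.ext ?_ ?_
        · have : (Algebra.TensorProduct.assoc K K K (FaaDiBruno K) (FaaDiBruno K)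
            (FaaDiBruno K)).toAlgHom.comp includeLeft = lift j₁ j₂ (fun _ _ => Commute.all _ _) := by
            refine Algebra.TensorProduct.ext ?_ ?_ <;> ext x <;> simp [j₁, j₂]; rfl
          rw [lift_comp_includeLeft, ← this]
          ext x; simp
        · ext x; simp [j₃]; rfl
      have h2 : map (.id K (FaaDiBruno K)) (comulHom K) =
          lift j₁ ((lift j₂ j₃ (fun _ _ => Commute.all _ _)).comp (comulHom K))
            (fun _ _ => Commute.all _ _) := by
        have : lift j₂ j₃ (fun _ _ => Commute.all _ _) = includeRight := by
          refine Algebra.TensorProduct.ext ?_ ?_ <;> ext x <;> simp [j₂, j₃]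
        rw [this]
        refine Algebra.TensorProduct.ext ?_ ?_ <;> ext x <;> simp [j₁]
      rw [← AlgHom.comp_assoc, h1, h2]
      refine algHom_ext_series ?_
      refine (series_comul _ _).trans (Eq.trans ?_ (series_comul _ _).symm)
      refine Eq.trans ?_ (congrArg (fun z => PowerSeries.subst _ z) (series_comul j₂ j₃).symm)
      refine (congrArg (fun z => PowerSeries.subst z _) (series_comul j₁ j₂)).trans ?_
      exact (PowerSeries.subst_comp_subst_apply (hasSubst_expSeries _) (hasSubst_expSeries _)
        _).symm)
    (by
      have h1 : map (counitHom K) (.id K (FaaDiBruno K)) =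
          lift ((includeLeft).comp (counitHom K)) includeRight (fun _ _ => Commute.all _ _) := by
        refine Algebra.TensorProduct.ext ?_ ?_ <;> ext x <;> simp
      rw [h1]
      refine algHom_ext_series ?_
      refine (series_comul _ _).trans ?_
      have h2 : (expSeries K fun n => ((includeLeft : K →ₐ[K] K ⊗[K] FaaDiBruno K).comp
          (counitHom K)) (a K n)) = PowerSeries.X := series_counit
      rw [h2, PowerSeries.X_subst]
      rfl)
    (by
      have h1 : map (.id K (FaaDiBruno K)) (counitHom K) =
          lift includeLeft ((includeRight).comp (counitHom K)) (fun _ _ => Commute.all _ _) := by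
        refine Algebra.TensorProduct.ext ?_ ?_ <;> ext x <;> simp
      rw [h1]
      refine algHom_ext_series ?_
      refine (series_comul _ _).trans ?_
      have h2 : (expSeries K fun n => ((includeRight : K →ₐ[K] FaaDiBruno K ⊗[K] K).comp
          (counitHom K)) (a K n)) = PowerSeries.X := by
        refine Eq.trans ?_ (series_counit (K := K))
        congr 1
        funext n
        exact (Algebra.TensorProduct.includeRight : K →ₐ[K] FaaDiBruno K ⊗[K] K).commutes _
      rw [h2, PowerSeries.subst_X (hasSubst_expSeries _)]
      rfl)

theorem isUnit_coeff_one_series [CharZero K] :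
    IsUnit (PowerSeries.coeff 1 (expSeries K (a K))) := by
  simp [coeff_expSeries, a]

/-- The antipode: `a_n ↦ n!` times the `t^n`-coefficient of the compositional inverse of
`∑ a_m t^m / m!`. -/
def antipodeHom [CharZero K] : FaaDiBruno K →ₐ[K] FaaDiBruno K :=
  evalHom K fun i => ((i + 2)! : K) • PowerSeries.coeff (i + 2)
    (PowerSeries.substInvOfIsUnit (expSeries K (a K)) isUnit_coeff_one_series)

theorem series_antipode [CharZero K] :
    expSeries K (fun n => antipodeHom (a K n)) =
      PowerSeries.substInvOfIsUnit (expSeries K (a K)) isUnit_coeff_one_series := by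
  ext n
  rcases n with _ | _ | i
  · rw [PowerSeries.coeff_zero_eq_constantCoeff_apply, constantCoeff_expSeries,
      PowerSeries.coeff_zero_eq_constantCoeff_apply,
      PowerSeries.constantCoeff_substInvOfIsUnit]
  · have h1 : (isUnit_coeff_one_series (K := K)).unit = 1 :=
      Units.ext (by simp [coeff_expSeries, a])
    rw [zero_add, PowerSeries.coeff_one_substInvOfIsUnit, h1]
    simp [coeff_expSeries, a]
  · rw [coeff_expSeries _ (by omega)]
    simp only [antipodeHom, evalHom_a]
    rw [smul_smul, inv_mul_cancel₀ (by exact_mod_cast (i + 2).factorial_ne_zero), one_smul]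

instance [CharZero K] : HopfAlgebra K (FaaDiBruno K) :=
  HopfAlgebra.ofAlgHom antipodeHom
    (by
      refine algHom_ext_series ?_
      refine (series_comul _ _).trans (Eq.trans ?_ series_counit.symm)
      rw [series_antipode]
      exact PowerSeries.subst_substInvOfIsUnit_right _ (constantCoeff_expSeries _) _)
    (by
      refine algHom_ext_series ?_
      refine (series_comul _ _).trans (Eq.trans ?_ series_counit.symm)
      rw [series_antipode]
      exact PowerSeries.subst_substInvOfIsUnit_left _ (constantCoeff_expSeries _) _)

end FaaDiBruno

/-! ### The shuffle Hopf algebra -/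

/-- All shuffles of two words, listed with multiplicity. -/
def shuffles {α : Type*} : List α → List α → List (List α)
  | [], w => [w]
  | a :: v, [] => [a :: v]
  | a :: v, b :: w =>
      (shuffles v (b :: w)).map (List.cons a) ++ (shuffles (a :: v) w).map (List.cons b)

/-- The vector space with basis the vectors `(n_1, …, n_r)` of positive integers. -/
def ShuffleAlgebra (K : Type*) [Field K] : Type _ := List ℕ+ →₀ K

namespace ShuffleAlgebra

variable (K : Type*) [Field K]

instance : AddCommGroup (ShuffleAlgebra K) := inferInstanceAs (AddCommGroup (List ℕ+ →₀ K))

instance : Module K (ShuffleAlgebra K) := inferInstanceAs (Module K (List ℕ+ →₀ K))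

/-- The basis `u^w`. -/
def basis : Module.Basis (List ℕ+) K (ShuffleAlgebra K) :=
  (Finsupp.basisSingleOne : Module.Basis (List ℕ+) K (List ℕ+ →₀ K))

/-- The basis element `u^w`. -/
def u (w : List ℕ+) : ShuffleAlgebra K := basis K w

/-- The shuffle product `u^v u^w = ∑ u^z`, over all shuffles `z` of `v` and `w` (with
multiplicity), as a bilinear map. -/
def mulLin : ShuffleAlgebra K →ₗ[K] ShuffleAlgebra K →ₗ[K] ShuffleAlgebra K :=
  (basis K).constr K fun v => (basis K).constr K fun w => ((shuffles v w).map (u K)).sum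

instance : Mul (ShuffleAlgebra K) := ⟨fun x y => mulLin K x y⟩

instance : One (ShuffleAlgebra K) := ⟨u K []⟩

/-- Prepending the letter `c` to all words. -/
def prepend (c : ℕ+) : ShuffleAlgebra K →ₗ[K] ShuffleAlgebra K :=
  (basis K).constr K fun w => u K (c :: w)

variable {K}

@[simp] theorem basis_eq (w : List ℕ+) : basis K w = u K w := rfl

@[simp] theorem prepend_u (c : ℕ+) (w : List ℕ+) : prepend K c (u K w) = u K (c :: w) :=
  (basis K).constr_basis K _ w

theorem mul_def (x y : ShuffleAlgebra K) : x * y = mulLin K x y := rfl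

theorem one_def : (1 : ShuffleAlgebra K) = u K [] := rfl

theorem u_mul_u (v w : List ℕ+) : u K v * u K w = ((shuffles v w).map (u K)).sum := by
  rw [mul_def, mulLin, ← basis_eq v, Module.Basis.constr_basis, ← basis_eq w,
    Module.Basis.constr_basis]

theorem u_cons_mul_u_cons (c d : ℕ+) (v w : List ℕ+) :
    u K (c :: v) * u K (d :: w) =
      prepend K c (u K v * u K (d :: w)) + prepend K d (u K (c :: v) * u K w) := by
  rw [u_mul_u, u_mul_u, u_mul_u, shuffles, List.map_append, List.sum_append, map_list_sum,
    map_list_sum]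
  simp [Function.comp_def]

theorem ind {p : ShuffleAlgebra K → Prop} (hu : ∀ w, p (u K w)) (h0 : p 0)
    (ha : ∀ x y, p x → p y → p (x + y)) (hs : ∀ (r : K) x, p x → p (r • x))
    (x : ShuffleAlgebra K) : p x := by
  have hx : x ∈ Submodule.span K (Set.range (basis K)) := by
    rw [(basis K).span_eq]; trivial
  induction hx using Submodule.span_induction with
  | mem x h => obtain ⟨w, rfl⟩ := h; exact hu w
  | zero => exact h0
  | add x y _ _ hx hy => exact ha x y hx hy
  | smul r x _ hx => exact hs r x hx

theorem prepend_mul_prepend (c d : ℕ+) (x y : ShuffleAlgebra K) :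
    prepend K c x * prepend K d y =
      prepend K c (x * prepend K d y) + prepend K d (prepend K c x * y) := by
  have h : (mulLin K).compl₁₂ (prepend K c) (prepend K d) =
      ((mulLin K).compl₂ (prepend K d)).compr₂ (prepend K c) +
        ((mulLin K).comp (prepend K c)).compr₂ (prepend K d) := by
    refine (basis K).ext fun v => (basis K).ext fun w => ?_
    have := u_cons_mul_u_cons (K := K) c d v w
    simpa [mul_def] using this
  exact congrArg (fun f => f x y) h

theorem nil_mul (x : ShuffleAlgebra K) : u K [] * x = x := by
  have h : mulLin K (u K []) = LinearMap.id := by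
    refine (basis K).ext fun w => ?_
    have := u_mul_u (K := K) [] w
    simpa [mul_def, shuffles] using this
  exact congrArg (fun f => f x) h

theorem u_comm : ∀ v w : List ℕ+, u K v * u K w = u K w * u K v
  | [], w => by cases w <;> simp [u_mul_u, shuffles]
  | a :: v, [] => by simp [u_mul_u, shuffles]
  | a :: v, b :: w => by
      rw [u_cons_mul_u_cons, u_cons_mul_u_cons, u_comm v (b :: w), u_comm (a :: v) w, add_comm]
  termination_by v w => v.length + w.length

theorem mul_comm' (x y : ShuffleAlgebra K) : x * y = y * x := by
  have h : mulLin K = (mulLin K).flip :=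
    (basis K).ext fun v => (basis K).ext fun w => u_comm v w
  exact congrArg (fun f => f x y) h

theorem mul_add' (x y z : ShuffleAlgebra K) : x * (y + z) = x * y + x * z :=
  map_add (mulLin K x) y z

theorem add_mul' (x y z : ShuffleAlgebra K) : (x + y) * z = x * z + y * z := by
  simp [mul_def]

theorem u_assoc : ∀ v w z : List ℕ+, u K v * u K w * u K z = u K v * (u K w * u K z)
  | [], w, z => by rw [nil_mul, nil_mul]
  | a :: v, [], z => by rw [mul_comm' _ (u K []), nil_mul, nil_mul]
  | a :: v, b :: w, [] => by rw [mul_comm' _ (u K []), nil_mul, mul_comm' _ (u K []), nil_mul]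
  | a :: v, b :: w, c :: z => by
      have h1 := u_assoc v (b :: w) (c :: z)
      have h2 := u_assoc (a :: v) w (c :: z)
      have h3 := u_assoc (a :: v) (b :: w) z
      rw [u_cons_mul_u_cons, add_mul'] at h3
      rw [u_cons_mul_u_cons b c, mul_add'] at h1
      rw [u_cons_mul_u_cons a b, u_cons_mul_u_cons b c, add_mul', mul_add', ← prepend_u c z,
        prepend_mul_prepend, prepend_mul_prepend, ← prepend_u a v, prepend_mul_prepend,
        prepend_mul_prepend]
      simp only [prepend_u]
      rw [h2, h1, map_add, ← h3, map_add]
      abel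
  termination_by v w z => v.length + w.length + z.length

theorem mul_assoc' (x y z : ShuffleAlgebra K) : x * y * z = x * (y * z) := by
  refine ind (p := fun x => x * y * z = x * (y * z)) (fun v => ?_) ?_ ?_ ?_ x
  · refine ind (p := fun y => u K v * y * z = u K v * (y * z)) (fun w => ?_) ?_ ?_ ?_ y
    · refine ind (p := fun z => u K v * u K w * z = u K v * (u K w * z)) (fun t => u_assoc v w t) ?_ ?_ ?_ z
      · simp [mul_def]
      · intro x y hx hy; rw [mul_add', mul_add', mul_add', hx, hy]
      · intro r x hx; simp only [mul_def, map_smul] at hx ⊢; rw [hx]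
    · simp [mul_def]
    · intro x y hx hy; rw [mul_add', add_mul', add_mul', mul_add', hx, hy]
    · intro r x hx; simp only [mul_def, map_smul, LinearMap.smul_apply] at hx ⊢; rw [hx]
  · simp [mul_def]
  · intro x y hx hy; rw [add_mul', add_mul', add_mul', hx, hy]
  · intro r x hx; simp only [mul_def, map_smul, LinearMap.smul_apply] at hx ⊢; rw [hx]

instance : CommRing (ShuffleAlgebra K) :=
  { (inferInstance : AddCommGroup (ShuffleAlgebra K)),
    (inferInstance : Mul (ShuffleAlgebra K)),
    (inferInstance : One (ShuffleAlgebra K)) with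
    left_distrib := mul_add'
    right_distrib := add_mul'
    zero_mul := fun x => by simp [mul_def]
    mul_zero := fun x => by simp [mul_def]
    mul_assoc := mul_assoc'
    one_mul := nil_mul
    mul_one := fun x => by rw [mul_comm']; exact nil_mul x
    mul_comm := mul_comm' }

instance : Algebra K (ShuffleAlgebra K) :=
  Algebra.ofModule (fun r x y => by simp [mul_def]) (fun r x y => by simp [mul_def])

variable (K) in
/-- Deconcatenation `Δ u^w = ∑ u^{w₁} ⊗ u^{w₂}`, over all factorisations `w = w₁ w₂`. -/
def comulLin : ShuffleAlgebra K →ₗ[K] ShuffleAlgebra K ⊗[K] ShuffleAlgebra K :=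
  (basis K).constr K fun w =>
    ∑ i ∈ Finset.range (w.length + 1), u K (w.take i) ⊗ₜ[K] u K (w.drop i)

variable (K) in
/-- The counit: the coefficient of the empty word. -/
def counitLin : ShuffleAlgebra K →ₗ[K] K := (basis K).coord []

theorem comulLin_u (w : List ℕ+) : comulLin K (u K w) =
    ∑ i ∈ Finset.range (w.length + 1), u K (w.take i) ⊗ₜ[K] u K (w.drop i) :=
  (basis K).constr_basis K _ w

theorem counitLin_nil : counitLin K (u K []) = 1 := by
  simp [counitLin, ← basis_eq]

theorem counitLin_prepend (c : ℕ+) (x : ShuffleAlgebra K) : counitLin K (prepend K c x) = 0 := by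
  have h : (counitLin K).comp (prepend K c) = 0 := by
    refine (basis K).ext fun w => ?_
    simp only [LinearMap.comp_apply, basis_eq, prepend_u]
    simp [counitLin, ← basis_eq]
  exact congrArg (fun f => f x) h

theorem comulLin_prepend (c : ℕ+) (x : ShuffleAlgebra K) :
    comulLin K (prepend K c x) =
      1 ⊗ₜ prepend K c x + (prepend K c).rTensor _ (comulLin K x) := by
  have h : (comulLin K).comp (prepend K c) =
      (TensorProduct.mk K _ _ 1).comp (prepend K c) +
        ((prepend K c).rTensor _).comp (comulLin K) := by
    refine (basis K).ext fun w => ?_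
    simp only [LinearMap.comp_apply, LinearMap.add_apply, basis_eq, prepend_u, comulLin_u,
      map_sum, LinearMap.rTensor_tmul, TensorProduct.mk_apply]
    rw [List.length_cons, Finset.sum_range_succ' _ (w.length + 1), add_comm]
    simp [one_def]
  exact congrArg (fun f => f x) h

theorem comulLin_one : comulLin K 1 = 1 ⊗ₜ 1 := by
  rw [one_def, comulLin_u]; simp

/-- Words are built from the empty word by prepending letters. -/
theorem linearMap_ext {M : Type*} [AddCommGroup M] [Module K M] {f g : ShuffleAlgebra K →ₗ[K] M}
    (h1 : f 1 = g 1) (h2 : ∀ c w, f (u K w) = g (u K w) →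
      f (prepend K c (u K w)) = g (prepend K c (u K w))) : f = g := by
  refine (basis K).ext fun w => ?_
  induction w with
  | nil => exact h1
  | cons c w ih => have := h2 c w ih; rwa [prepend_u] at this

theorem rTensor_prepend_mul (c d : ℕ+) (x y : ShuffleAlgebra K ⊗[K] ShuffleAlgebra K) :
    (prepend K c).rTensor _ x * (prepend K d).rTensor _ y =
      (prepend K c).rTensor _ (x * (prepend K d).rTensor _ y) +
        (prepend K d).rTensor _ ((prepend K c).rTensor _ x * y) := by
  induction x with
  | zero => simp
  | add x₁ x₂ h1 h2 => simp only [map_add, add_mul, h1, h2]; abel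
  | tmul x₁ x₂ =>
    induction y with
    | zero => simp
    | add y₁ y₂ h1 h2 => simp only [map_add, mul_add, h1, h2]; abel
    | tmul y₁ y₂ =>
      simp only [LinearMap.rTensor_tmul, Algebra.TensorProduct.tmul_mul_tmul]
      rw [prepend_mul_prepend, TensorProduct.add_tmul]

theorem rTensor_prepend_mul_right (c : ℕ+) (x : ShuffleAlgebra K ⊗[K] ShuffleAlgebra K)
    (y : ShuffleAlgebra K) :
    (prepend K c).rTensor _ x * (1 ⊗ₜ y) = (prepend K c).rTensor _ (x * (1 ⊗ₜ y)) := by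
  induction x with
  | zero => simp
  | add x₁ x₂ h1 h2 => simp only [map_add, add_mul, h1, h2]
  | tmul x₁ x₂ => simp [Algebra.TensorProduct.tmul_mul_tmul]

theorem comulLin_u_mul : ∀ v w : List ℕ+,
    comulLin K (u K v * u K w) = comulLin K (u K v) * comulLin K (u K w)
  | [], w => by
      rw [← one_def, one_mul, comulLin_one, ← Algebra.TensorProduct.one_def, one_mul]
  | a :: v, [] => by
      rw [← one_def, mul_one, comulLin_one, ← Algebra.TensorProduct.one_def, mul_one]
  | a :: v, b :: w => by
      have h1 := comulLin_u_mul v (b :: w)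
      have h2 := comulLin_u_mul (a :: v) w
      rw [u_cons_mul_u_cons, map_add, comulLin_prepend, comulLin_prepend, h1, h2]
      rw [← prepend_u a v, ← prepend_u b w, comulLin_prepend, comulLin_prepend]
      simp only [add_mul, mul_add, map_add]
      rw [rTensor_prepend_mul, rTensor_prepend_mul_right,
        mul_comm ((1 : ShuffleAlgebra K) ⊗ₜ[K] prepend K a (u K v)) ((prepend K b).rTensor _ _),
        rTensor_prepend_mul_right,
        Algebra.TensorProduct.tmul_mul_tmul, prepend_mul_prepend, TensorProduct.tmul_add, one_mul,
        mul_comm _ (comulLin K (u K w))]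
      abel
  termination_by v w => v.length + w.length

theorem comulLin_mul (x y : ShuffleAlgebra K) :
    comulLin K (x * y) = comulLin K x * comulLin K y := by
  have h : (mulLin K).compr₂ (comulLin K) =
      (LinearMap.mul K (ShuffleAlgebra K ⊗[K] ShuffleAlgebra K)).compl₁₂
        (comulLin K) (comulLin K) :=
    (basis K).ext fun v => (basis K).ext fun w => comulLin_u_mul v w
  exact congrArg (fun f => f x y) h

theorem counitLin_mul (x y : ShuffleAlgebra K) :
    counitLin K (x * y) = counitLin K x * counitLin K y := by
  have h : (mulLin K).compr₂ (counitLin K) =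
      (LinearMap.mul K K).compl₁₂ (counitLin K) (counitLin K) := by
    refine (basis K).ext fun v => (basis K).ext fun w => ?_
    change counitLin K (u K v * u K w) = counitLin K (u K v) * counitLin K (u K w)
    rcases v with _ | ⟨a, v⟩
    · rw [nil_mul, counitLin_nil, one_mul]
    · rcases w with _ | ⟨b, w⟩
      · rw [mul_comm, nil_mul, counitLin_nil, mul_one]
      · rw [u_cons_mul_u_cons, map_add, counitLin_prepend, counitLin_prepend, ← prepend_u a,
          counitLin_prepend]
        simp
  exact congrArg (fun f => f x y) h

theorem assoc_rTensor_prepend (c : ℕ+) :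
    (TensorProduct.assoc K (ShuffleAlgebra K) (ShuffleAlgebra K) (ShuffleAlgebra K)).toLinearMap ∘ₗ
        (comulLin K).rTensor _ ∘ₗ (prepend K c).rTensor _ =
      TensorProduct.mk K _ _ 1 ∘ₗ (prepend K c).rTensor _ +
        (prepend K c).rTensor _ ∘ₗ (TensorProduct.assoc K _ _ _).toLinearMap ∘ₗ
          (comulLin K).rTensor _ := by
  have h (y : ShuffleAlgebra K) :
      (TensorProduct.assoc K (ShuffleAlgebra K) (ShuffleAlgebra K) (ShuffleAlgebra K)).toLinearMap ∘ₗ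
          (TensorProduct.mk K _ _).flip y ∘ₗ (prepend K c).rTensor _ =
        (prepend K c).rTensor _ ∘ₗ (TensorProduct.assoc K _ _ _).toLinearMap ∘ₗ
          (TensorProduct.mk K _ _).flip y := TensorProduct.ext' fun p q => rfl
  refine TensorProduct.ext' fun x y => ?_
  have := congrArg (fun f => f (comulLin K x)) (h y)
  simp only [LinearMap.comp_apply, LinearMap.flip_apply, TensorProduct.mk_apply] at this
  simp only [LinearMap.comp_apply, LinearMap.add_apply, LinearMap.rTensor_tmul, comulLin_prepend,
    TensorProduct.add_tmul, TensorProduct.mk_apply]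
  rw [LinearMap.map_add, this]
  rfl

instance : Coalgebra K (ShuffleAlgebra K) where
  comul := comulLin K
  counit := counitLin K
  coassoc := by
    refine linearMap_ext ?_ fun c w ih => ?_
    · simp [comulLin_one]
    · simp only [LinearMap.comp_apply] at ih ⊢
      have h3 := congrArg (fun f => f (comulLin K (u K w))) (assoc_rTensor_prepend c)
      simp only [LinearMap.comp_apply, LinearMap.add_apply, TensorProduct.mk_apply] at h3
      rw [comulLin_prepend, map_add, LinearMap.map_add, map_add, h3, ih]
      simp only [LinearMap.rTensor_tmul, LinearMap.lTensor_tmul, comulLin_one, comulLin_prepend,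
        TensorProduct.tmul_add, LinearEquiv.coe_coe, TensorProduct.assoc_tmul]
      rw [add_assoc]
      congr 2
      exact congrArg (fun f => f (comulLin K (u K w)))
        ((LinearMap.rTensor_comp_lTensor _ (prepend K c) (comulLin K)).trans
          (LinearMap.lTensor_comp_rTensor _ (prepend K c) (comulLin K)).symm)
  rTensor_counit_comp_comul := by
    refine linearMap_ext ?_ fun c w ih => ?_
    · rw [LinearMap.comp_apply, comulLin_one]; simp [one_def, counitLin_nil]
    · simp only [LinearMap.comp_apply, comulLin_prepend, map_add, LinearMap.rTensor_tmul]
      rw [← LinearMap.rTensor_comp_apply]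
      have : (counitLin K).comp (prepend K c) = 0 := LinearMap.ext (counitLin_prepend c)
      simp [this, one_def, counitLin_nil]
  lTensor_counit_comp_comul := by
    refine linearMap_ext ?_ fun c w ih => ?_
    · rw [LinearMap.comp_apply, comulLin_one]; simp [one_def, counitLin_nil]
    · have h3 := congrArg (fun f => f (comulLin K (u K w)))
        ((LinearMap.lTensor_comp_rTensor _ (prepend K c) (counitLin K)).trans
          (LinearMap.rTensor_comp_lTensor _ (prepend K c) (counitLin K)).symm)
      simp only [LinearMap.comp_apply] at h3 ih
      rw [LinearMap.comp_apply, comulLin_prepend, map_add, LinearMap.lTensor_tmul, h3, ih,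
        counitLin_prepend]
      simp

instance : Bialgebra K (ShuffleAlgebra K) :=
  Bialgebra.mk' K (ShuffleAlgebra K) counitLin_nil (counitLin_mul _ _)
    (comulLin_one.trans rfl) (comulLin_mul _ _)

variable (K) in
/-- The antipode `u^w ↦ (-1)^{|w|} u^{w reversed}`. -/
def antipodeLin : ShuffleAlgebra K →ₗ[K] ShuffleAlgebra K :=
  (basis K).constr K fun w => (-1 : K) ^ w.length • u K w.reverse

theorem antipodeLin_u (w : List ℕ+) :
    antipodeLin K (u K w) = (-1 : K) ^ w.length • u K w.reverse :=
  (basis K).constr_basis K _ w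

theorem sum_reverse_take (w : List ℕ+) : ∀ (c : ℕ+) (r : List ℕ+),
    ∑ i ∈ Finset.range (w.length + 1),
      (-1 : K) ^ i • (u K ((w.take i).reverse ++ c :: r) * u K (w.drop i)) =
        prepend K c (u K r * u K w) := by
  induction w with
  | nil => intro c r; simp [← one_def]
  | cons b w ih =>
    intro c r
    rw [List.length_cons, Finset.sum_range_succ' _ (w.length + 1)]
    have := ih b (c :: r)
    simp only [List.take_succ_cons, List.drop_succ_cons, List.reverse_cons, List.append_assoc,
      List.cons_append, List.nil_append, pow_succ, mul_neg, mul_one, neg_smul,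
      Finset.sum_neg_distrib, this]
    simp [u_cons_mul_u_cons]

/-- A right convolution inverse of the identity, by recursion on the length of words. -/
def rightInv (K : Type*) [Field K] : List ℕ+ → ShuffleAlgebra K
  | [] => 1
  | a :: w => -∑ i ∈ Finset.range (w.length + 1), u K (a :: w.take i) * rightInv K (w.drop i)
  termination_by w => w.length
  decreasing_by simp

instance : HopfAlgebra K (ShuffleAlgebra K) := by
  refine HopfAlgebra.ofConvInverse (antipodeLin K) ?_ ?_
  all_goals
    have hl : WithConv.toConv (antipodeLin K) *
        WithConv.toConv (LinearMap.id : ShuffleAlgebra K →ₗ[K] ShuffleAlgebra K) = 1 := by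
      refine WithConv.ext ((basis K).ext fun w => ?_)
      change LinearMap.mul' K _ (TensorProduct.map _ _ (comulLin K (u K w))) =
        algebraMap K _ (counitLin K (u K w))
      rw [comulLin_u]
      simp only [map_sum, TensorProduct.map_tmul, LinearMap.mul'_apply,
        antipodeLin_u, LinearMap.id_apply]
      rcases w with _ | ⟨b, w⟩
      · simp [counitLin_nil]
        simp [← one_def]
      · rw [← prepend_u, counitLin_prepend, map_zero, List.length_cons,
          Finset.sum_range_succ' _ (w.length + 1)]
        have := sum_reverse_take (K := K) w b []
        simp only [List.take_succ_cons, List.drop_succ_cons, List.reverse_cons,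
          List.length_cons] at this ⊢
        have h2 : ∀ i ∈ Finset.range (w.length + 1),
            (-1 : K) ^ ((w.take i).length + 1) • u K ((w.take i).reverse ++ [b]) *
                u K (w.drop i) =
              -((-1 : K) ^ i • (u K ((w.take i).reverse ++ [b]) * u K (w.drop i))) := by
          intro i hi
          rw [List.length_take, min_eq_left (by have := Finset.mem_range.mp hi; omega), pow_succ,
            mul_neg_one, neg_smul, neg_mul, smul_mul_assoc]
        rw [Finset.sum_congr rfl h2, Finset.sum_neg_distrib, this]
        simp [← one_def]
    have hr : WithConv.toConv (LinearMap.id : ShuffleAlgebra K →ₗ[K] ShuffleAlgebra K) *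
        WithConv.toConv ((basis K).constr K (rightInv K)) = 1 := by
      refine WithConv.ext ((basis K).ext fun w => ?_)
      change LinearMap.mul' K _ (TensorProduct.map _ _ (comulLin K (u K w))) =
        algebraMap K _ (counitLin K (u K w))
      rw [comulLin_u]
      have hb : ∀ z, (basis K).constr K (rightInv K) (u K z) = rightInv K z :=
        (basis K).constr_basis K _
      simp only [map_sum, TensorProduct.map_tmul, LinearMap.mul'_apply,
        hb, LinearMap.id_apply]
      rcases w with _ | ⟨b, w⟩
      · simp [counitLin_nil, rightInv]
        simp [← one_def]
      · rw [← prepend_u, counitLin_prepend, map_zero, List.length_cons,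
          Finset.sum_range_succ' _ (w.length + 1)]
        rw [List.take_zero, List.drop_zero, ← one_def, one_mul, rightInv]
        simp
  · exact hl
  · rwa [← left_inv_eq_right_inv hl hr] at hr

end ShuffleAlgebra

/-! ### The enveloping algebra of the free Lie algebra -/

section Concatenation

attribute [local instance] LieRing.ofAssociativeRing

variable (K : Type*) [Field K]

/-- The enveloping algebra `U(A)` of the free Lie algebra `A` on generators `X_n`, `n ≥ 1`. -/
abbrev FreeEnveloping : Type _ := UniversalEnvelopingAlgebra K (FreeLieAlgebra K ℕ+)

/-- The generator `X_n` of `U(A)`. -/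
def genX (n : ℕ+) : FreeEnveloping K :=
  UniversalEnvelopingAlgebra.ι K (FreeLieAlgebra.of K n)

/-- The coproduct of `U(A)`: the algebra morphism for which all `X_n` are primitive. -/
def FreeEnveloping.comulHom : FreeEnveloping K →ₐ[K] FreeEnveloping K ⊗[K] FreeEnveloping K :=
  UniversalEnvelopingAlgebra.lift K
    (FreeLieAlgebra.lift K fun n => genX K n ⊗ₜ[K] 1 + 1 ⊗ₜ[K] genX K n)

/-- The counit of `U(A)`: the algebra morphism with `X_n ↦ 0`. -/
def FreeEnveloping.counitHom : FreeEnveloping K →ₐ[K] K :=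
  UniversalEnvelopingAlgebra.lift K (FreeLieAlgebra.lift K fun _ => 0)

/-- The linear basis of `U(A)` given by the words `X_{n_1} X_{n_2} ⋯ X_{n_r}`. -/
def wordBasis : Module.Basis (List ℕ+) K (FreeEnveloping K) :=
  ((FreeAlgebra.basisFreeMonoid K ℕ+).map
    (FreeLieAlgebra.universalEnvelopingEquivFreeAlgebra K ℕ+).symm.toLinearEquiv).reindex
      FreeMonoid.toList

theorem wordBasis_apply (w : List ℕ+) : wordBasis K w = (w.map (genX K)).prod := by
  have h : (FreeLieAlgebra.universalEnvelopingEquivFreeAlgebra K ℕ+).symm.toLinearEquiv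
      (FreeAlgebra.basisFreeMonoid K ℕ+ (FreeMonoid.ofList w)) = (w.map (genX K)).prod := by
    simp [FreeAlgebra.basisFreeMonoid, FreeAlgebra.equivMonoidAlgebraFreeMonoid,
      FreeMonoid.lift_apply, map_list_prod, Function.comp_def,
      FreeLieAlgebra.universalEnvelopingEquivFreeAlgebra]
    rfl
  simpa [wordBasis] using h

/-- The pairing of `H` with `U(A)` for which `u^w` is the dual basis to `X_w`. -/
def pairing : ShuffleAlgebra K →ₗ[K] Module.Dual K (FreeEnveloping K) :=
  (ShuffleAlgebra.basis K).constr K fun w => (wordBasis K).coord w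

end Concatenation

namespace FaaDiBruno

variable (K : Type*) [Field K]

/-- The Connes–Moscovici coordinate
`δ_n = ∑_{k=1}^n (-1)^{k-1} (k-1)! B_{n,k}(a_2, a_3, …)`, `n ≥ 1`. -/
def delta (n : ℕ) : FaaDiBruno K :=
  ∑ k ∈ Finset.Icc 1 n, ((-1 : K) ^ (k - 1) * ((k - 1)! : K)) •
    bellPoly K (fun m => a K (m + 1)) n k

/-- The terms `δ_{i_1} ⋯ δ_{i_m} ⊗ δ_j` with `m ≥ 2` and `i_1 + ⋯ + i_m + j = n`, spanning the
part of `Δ δ_n` which is neither linear nor bilinear in the `δ_i`. -/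
def higherTerms (n : ℕ) : Submodule K (FaaDiBruno K ⊗[K] FaaDiBruno K) :=
  Submodule.span K {z | ∃ (s : Multiset ℕ) (j : ℕ), 2 ≤ s.card ∧ (∀ i ∈ s, 1 ≤ i) ∧ 1 ≤ j ∧
    s.sum + j = n ∧ z = (s.map (delta K)).prod ⊗ₜ[K] delta K j}

/-- The homogeneous polynomials of degree `d`, for the grading with `deg a_n = n - 1`. -/
def homogeneous (d : ℕ) : Submodule K (FaaDiBruno K) :=
  (MvPolynomial.weightedHomogeneousSubmodule K (fun i : ℕ => i + 1) d :
    Submodule K (MvPolynomial ℕ K))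

/-- The functional `a'_n` (for `n ≥ 2`): the coefficient of the monomial `a_n`. Thus
`⟨a'_n, a_m⟩ = δ_{n,m}`, and `a'_n` vanishes on `1` and on products of several generators. -/
def aDual (n : ℕ) : FaaDiBruno K →ₗ[K] K :=
  (MvPolynomial.lcoeff K (Finsupp.single (n - 2) 1) : MvPolynomial ℕ K →ₗ[K] K)

/-- `b'_n = (n+1)! a'_{n+1}` for `n ≥ 1`. The type `WithConv` carries the convolution product
`⟨b' c', f⟩ = ⟨b' ⊗ c', Δ f⟩`. -/
def bDual (n : ℕ) : WithConv (FaaDiBruno K →ₗ[K] K) :=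
  WithConv.toConv (((n + 1)! : K) • aDual K (n + 1))

variable [CharZero K]

/-- The graded dual: the functionals vanishing on all but finitely many homogeneous
components. -/
def gradedDual : Set (WithConv (FaaDiBruno K →ₗ[K] K)) :=
  {b | ∃ N : ℕ, ∀ d > N, ∀ f ∈ homogeneous K d, b f = 0}

/-- Evaluation of a functional at `f`. -/
def evalAt (f : FaaDiBruno K) : WithConv (FaaDiBruno K →ₗ[K] K) →ₗ[K] K :=
  (LinearMap.applyₗ f).comp (WithConv.linearEquiv K (FaaDiBruno K →ₗ[K] K)).toLinearMap

/-- `b ⊗ c ↦ ⟨b, f⟩ ⟨c, g⟩`. -/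
def evalTensor (f g : FaaDiBruno K) :
    WithConv (FaaDiBruno K →ₗ[K] K) ⊗[K] WithConv (FaaDiBruno K →ₗ[K] K) →ₗ[K] K :=
  (LinearMap.mul' K K).comp (TensorProduct.map (evalAt K f) (evalAt K g))

section

attribute [local instance] LieRing.ofAssociativeRing

/-- The algebra morphism with `X_n ↦ b'_n` from `U(A)` to the functionals on the Faà di Bruno
Hopf algebra, under the convolution product. -/
def rho : FreeEnveloping K →ₐ[K] WithConv (FaaDiBruno K →ₗ[K] K) :=
  UniversalEnvelopingAlgebra.lift K (FreeLieAlgebra.lift K fun n : ℕ+ => bDual K n)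

end

end FaaDiBruno

/-- The composition `(n_1, …, n_r)` of `n` as a vector of positive integers. -/
def Composition.toWord {n : ℕ} (c : Composition n) : List ℕ+ :=
  List.ofFn fun i : Fin c.length => ⟨c.blocksFun i, c.blocks_pos' i i.isLt⟩

/-- The number `(n_r + 1) ∏_{i=2}^r (n_i + ⋯ + n_r)` for the nonempty list `(n_1, …, n_r)`. -/
def wordCoeff (l : List ℕ) : ℕ :=
  (l.getLastD 0 + 1) * ∏ i ∈ Finset.Icc 2 l.length, (l.drop (i - 1)).sum

end

noncomputable section

section LogExp

variable {K : Type*} [Field K] {A B : Type*} [CommRing A] [Algebra K A]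
  [CommRing B] [Algebra K B]

variable (K A) in
/-- The series `log (1 + t)`. -/
def logSeries : PowerSeries A :=
  expSeries K fun k => algebraMap K A ((-1) ^ (k - 1) * ((k - 1)! : K))

variable (K A) in
/-- The series `exp t - 1`. -/
def expSubOne : PowerSeries A := expSeries K fun _ => 1

variable (K) in
/-- `n!` times the coefficient of `t^n` in `log (1 + ∑ x_m t^m / m!)`. -/
def logSeq (x : ℕ → A) (n : ℕ) : A :=
  ∑ k ∈ Finset.Icc 1 n, ((-1 : K) ^ (k - 1) * ((k - 1)! : K)) • bellPoly K x n k

variable (K) in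
/-- `n!` times the coefficient of `t^n` in `exp (∑ x_m t^m / m!)`, for `n ≥ 1`. -/
def expSeq (x : ℕ → A) (n : ℕ) : A := ∑ k ∈ Finset.Icc 1 n, bellPoly K x n k

theorem hasSubst_logSeries : PowerSeries.HasSubst (logSeries K A) := hasSubst_expSeries _

theorem hasSubst_expSubOne : PowerSeries.HasSubst (expSubOne K A) := hasSubst_expSeries _

theorem map_logSeq (f : A →ₐ[K] B) (x : ℕ → A) (n : ℕ) :
    f (logSeq K x n) = logSeq K (fun m => f (x m)) n := by
  simp [logSeq, map_bellPoly]

theorem map_expSeq (f : A →ₐ[K] B) (x : ℕ → A) (n : ℕ) :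
    f (expSeq K x n) = expSeq K (fun m => f (x m)) n := by
  simp [expSeq, map_bellPoly]

theorem expSeries_eq_of_coeff {x : ℕ → A} {f : PowerSeries A}
    (h0 : PowerSeries.constantCoeff f = 0)
    (h : ∀ n, PowerSeries.coeff n f = ((n ! : K)⁻¹) • x n) : expSeries K x = f := by
  ext n
  rcases n with _ | n
  · rw [PowerSeries.coeff_zero_eq_constantCoeff_apply, constantCoeff_expSeries,
      PowerSeries.coeff_zero_eq_constantCoeff_apply, h0]
  · rw [coeff_expSeries _ (Nat.succ_ne_zero n), h]

/-- The value at `0` does not enter the exponential series. -/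
theorem expSeries_congr {x y : ℕ → A} (h : ∀ n ≠ 0, x n = y n) :
    expSeries K x = expSeries K y := by
  ext n
  by_cases hn : n = 0
  · simp [expSeries, hn]
  · rw [coeff_expSeries _ hn, coeff_expSeries _ hn, h n hn]

theorem bellPoly_congr {x y : ℕ → A} (h : ∀ n ≠ 0, x n = y n) (n k : ℕ) :
    bellPoly K x n k = bellPoly K y n k := by
  rw [bellPoly, expSeries_congr h, bellPoly]

theorem expSeq_congr {x y : ℕ → A} (h : ∀ n ≠ 0, x n = y n) (n : ℕ) :
    expSeq K x n = expSeq K y n := by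
  simp [expSeq, bellPoly_congr h]

theorem logSeq_congr {x y : ℕ → A} (h : ∀ n ≠ 0, x n = y n) (n : ℕ) :
    logSeq K x n = logSeq K y n := by
  simp [logSeq, bellPoly_congr h]

variable [CharZero K]

theorem PowerSeries.ext_derivative_of_algebra (K : Type*) [Field K] [CharZero K] {A : Type*}
    [CommRing A] [Algebra K A] {f g : PowerSeries A}
    (h : PowerSeries.derivative A f = PowerSeries.derivative A g)
    (h0 : PowerSeries.constantCoeff f = PowerSeries.constantCoeff g) : f = g := by
  ext n
  rcases n with _ | n
  · simpa using h0
  · have h1 := congrArg (PowerSeries.coeff n) h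
    rw [PowerSeries.coeff_derivative, PowerSeries.coeff_derivative] at h1
    have h2 : ∀ x : A, x * ((n : A) + 1) = ((n : K) + 1) • x := fun x => by
      rw [Algebra.smul_def, mul_comm]; simp
    rw [h2, h2] at h1
    exact smul_right_injective A (Nat.cast_add_one_ne_zero (R := K) n) h1

theorem derivative_expSeries (x : ℕ → A) :
    PowerSeries.derivative A (expSeries K x) =
      PowerSeries.C (x 1) + expSeries K (fun n => x (n + 1)) := by
  ext n
  rw [PowerSeries.coeff_derivative, coeff_expSeries _ (Nat.succ_ne_zero n), map_add]
  have h2 : ∀ x : A, x * ((n : A) + 1) = ((n : K) + 1) • x := fun x => by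
      rw [Algebra.smul_def, mul_comm]; simp
  have h3 : ((n : K) + 1) * ((n + 1)! : K)⁻¹ = (n ! : K)⁻¹ := by
    have h4 := Nat.cast_add_one_ne_zero (R := K) n
    have h5 : (n ! : K) ≠ 0 := by exact_mod_cast n.factorial_ne_zero
    rw [Nat.factorial_succ]; push_cast; field_simp
  rw [h2, smul_smul, h3]
  rcases n with _ | n
  · simp [expSeries]
  · rw [coeff_expSeries _ (Nat.succ_ne_zero n), PowerSeries.coeff_C, if_neg (by omega), zero_add]

theorem expSeries_logSeq (x : ℕ → A) :
    expSeries K (logSeq K x) = (logSeries K A).subst (expSeries K x) := by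
  refine expSeries_eq_of_coeff (PowerSeries.constantCoeff_subst_eq_zero
    (constantCoeff_expSeries _) _ (constantCoeff_expSeries _)) fun n => ?_
  rw [logSeries, coeff_subst_expSeries]
  congr 1
  exact Finset.sum_congr rfl fun k _ => by rw [mul_comm, ← Algebra.smul_def]

theorem expSeries_expSeq (x : ℕ → A) :
    expSeries K (expSeq K x) = (expSubOne K A).subst (expSeries K x) := by
  refine expSeries_eq_of_coeff (PowerSeries.constantCoeff_subst_eq_zero
    (constantCoeff_expSeries _) _ (constantCoeff_expSeries _)) fun n => ?_
  rw [expSubOne, coeff_subst_expSeries]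
  simp [expSeq]

theorem derivative_expSubOne :
    PowerSeries.derivative A (expSubOne K A) = 1 + expSubOne K A := by
  rw [expSubOne, derivative_expSeries, map_one]

theorem one_add_X_mul_derivative_logSeries :
    (1 + PowerSeries.X) * PowerSeries.derivative A (logSeries K A) = 1 := by
  have h : ∀ n, PowerSeries.coeff n (PowerSeries.derivative A (logSeries K A)) = (-1) ^ n := by
    intro n
    rw [PowerSeries.coeff_derivative, logSeries, coeff_expSeries _ (Nat.succ_ne_zero n),
      Nat.succ_sub_one, Algebra.smul_def, ← map_mul]
    have h4 := Nat.cast_add_one_ne_zero (R := K) n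
    have h5 : (n ! : K) ≠ 0 := by exact_mod_cast n.factorial_ne_zero
    have : ((n : A) + 1) = algebraMap K A (n + 1) := by simp
    rw [this, ← map_mul, Nat.factorial_succ, Nat.cast_mul, Nat.cast_succ]
    have h6 : ((n + 1 : K) * n !)⁻¹ * ((-1) ^ n * n !) * (n + 1) = (-1) ^ n := by field_simp
    rw [h6]; simp
  ext n
  rw [add_mul, one_mul, map_add]
  rcases n with _ | n
  · simp [h]
  · rw [PowerSeries.coeff_succ_X_mul, h, h, PowerSeries.coeff_one, if_neg (by omega)]; ring

theorem logSeries_subst_expSubOne :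
    (logSeries K A).subst (expSubOne K A) = PowerSeries.X := by
  have hs := hasSubst_expSubOne (K := K) (A := A)
  refine PowerSeries.ext_derivative_of_algebra K ?_ ?_
  · have h := congrArg (PowerSeries.subst (expSubOne K A))
      (one_add_X_mul_derivative_logSeries (K := K) (A := A))
    rw [PowerSeries.subst_mul hs, PowerSeries.subst_add hs, PowerSeries.subst_X hs,
      ← PowerSeries.coe_substAlgHom hs, map_one, PowerSeries.coe_substAlgHom hs] at h
    rw [PowerSeries.derivative_subst hs, derivative_expSubOne, PowerSeries.derivative_X, mul_comm,
      h]
  · rw [PowerSeries.constantCoeff_X]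
    exact PowerSeries.constantCoeff_subst_eq_zero
      (constantCoeff_expSeries _) _ (constantCoeff_expSeries _)

theorem expSubOne_subst_logSeries :
    (expSubOne K A).subst (logSeries K A) = PowerSeries.X := by
  have hs := hasSubst_expSubOne (K := K) (A := A)
  have hu : IsUnit (PowerSeries.coeff 1 (expSubOne K A)) := by
    simp [expSubOne, coeff_expSeries]
  have hr := PowerSeries.subst_substInvOfIsUnit_right (expSubOne K A)
    (constantCoeff_expSeries _) hu
  have h : logSeries K A = PowerSeries.substInvOfIsUnit _ hu := by
    conv_lhs => rw [← PowerSeries.X_subst (logSeries K A), ← hr]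
    rw [← PowerSeries.subst_comp_subst_apply hs (PowerSeries.HasSubst.substInvOfIsUnit _ _),
      logSeries_subst_expSubOne, PowerSeries.subst_X (PowerSeries.HasSubst.substInvOfIsUnit _ _)]
  rw [h, hr]

theorem expSeries_injective {x y : ℕ → A} (h : expSeries K x = expSeries K y) {n : ℕ}
    (hn : n ≠ 0) : x n = y n := by
  have h1 := congrArg (PowerSeries.coeff n) h
  rw [coeff_expSeries _ hn, coeff_expSeries _ hn] at h1
  exact smul_right_injective A
    (inv_ne_zero (by exact_mod_cast n.factorial_ne_zero : (n ! : K) ≠ 0)) h1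

theorem logSeq_expSeq (x : ℕ → A) {n : ℕ} (hn : n ≠ 0) : logSeq K (expSeq K x) n = x n := by
  refine expSeries_injective (K := K) ?_ hn
  rw [expSeries_logSeq, expSeries_expSeq, ← PowerSeries.subst_comp_subst_apply
    hasSubst_expSubOne (hasSubst_expSeries _), logSeries_subst_expSubOne,
    PowerSeries.subst_X (hasSubst_expSeries _)]

theorem expSeq_logSeq (x : ℕ → A) {n : ℕ} (hn : n ≠ 0) : expSeq K (logSeq K x) n = x n := by
  refine expSeries_injective (K := K) ?_ hn
  rw [expSeries_expSeq, expSeries_logSeq, ← PowerSeries.subst_comp_subst_apply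
    hasSubst_logSeries (hasSubst_expSeries _), expSubOne_subst_logSeries,
    PowerSeries.subst_X (hasSubst_expSeries _)]

/-- The logarithmic derivative of `1 + ∑ x_m t^m / m!`. -/
theorem derivative_expSeries_logSeq (x : ℕ → A) :
    PowerSeries.derivative A (expSeries K (logSeq K x)) * (1 + expSeries K x) =
      PowerSeries.derivative A (expSeries K x) := by
  have hs := hasSubst_expSeries (K := K) x
  have h := congrArg (PowerSeries.subst (expSeries K x))
      (one_add_X_mul_derivative_logSeries (K := K) (A := A))
  rw [PowerSeries.subst_mul hs, PowerSeries.subst_add hs, PowerSeries.subst_X hs,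
      ← PowerSeries.coe_substAlgHom hs, map_one, PowerSeries.coe_substAlgHom hs] at h
  rw [expSeries_logSeq, PowerSeries.derivative_subst hs]
  linear_combination (PowerSeries.derivative A (expSeries K x)) * h

end LogExp

namespace FaaDiBruno

variable {K : Type*} [Field K]

theorem delta_eq_logSeq (n : ℕ) : delta K n = logSeq K (fun m => a K (m + 1)) n := rfl

variable [CharZero K]

variable (K) in
/-- The coordinate change `a_{i+2} ↦ δ_{i+1}`. -/
def toDelta : FaaDiBruno K ≃ₐ[K] FaaDiBruno K :=
  AlgEquiv.ofAlgHom (evalHom K fun i => delta K (i + 1))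
    (evalHom K fun i => expSeq K (fun m => a K (m + 1)) (i + 1))
    (by
      refine algHom_ext' fun i => ?_
      simp only [AlgHom.comp_apply, evalHom_a, map_expSeq, AlgHom.id_apply]
      rw [expSeq_congr (y := delta K), funext delta_eq_logSeq, expSeq_logSeq _ (by omega)]
      rintro (_ | n) hn
      · exact absurd rfl hn
      · exact evalHom_a _ n)
    (by
      refine algHom_ext' fun i => ?_
      simp only [AlgHom.comp_apply, evalHom_a, delta_eq_logSeq, map_logSeq, AlgHom.id_apply]
      rw [logSeq_congr (y := expSeq K (fun m => a K (m + 1))), logSeq_expSeq _ (by omega)]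
      rintro (_ | n) hn
      · exact absurd rfl hn
      · exact evalHom_a _ n)

@[simp] theorem toDelta_a (i : ℕ) : toDelta K (a K (i + 2)) = delta K (i + 1) := evalHom_a _ i

theorem algebraicIndependent_delta :
    AlgebraicIndependent K (fun i : ℕ => delta K (i + 1)) := (toDelta K).injective

theorem adjoin_delta : Algebra.adjoin K (Set.range fun i : ℕ => delta K (i + 1)) = ⊤ := by
  rw [Algebra.adjoin_range_eq_range_aeval]
  exact (AlgHom.range_eq_top _).mpr (toDelta K).surjective

theorem a_eq_expSeq_delta {n : ℕ} (hn : n ≠ 0) : a K (n + 1) = expSeq K (delta K) n :=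
  (expSeq_logSeq (fun m => a K (m + 1)) hn).symm

theorem delta_induction {p : FaaDiBruno K → Prop} (hC : ∀ r : K, p (algebraMap K _ r))
    (hd : ∀ n, 1 ≤ n → p (delta K n)) (ha : ∀ f g, p f → p g → p (f + g))
    (hm : ∀ f g, p f → p g → p (f * g)) (f : FaaDiBruno K) : p f := by
  have hf : f ∈ Algebra.adjoin K (Set.range fun i : ℕ => delta K (i + 1)) := by
    rw [adjoin_delta]; trivial
  induction hf using Algebra.adjoin_induction with
  | mem x h => obtain ⟨i, rfl⟩ := h; exact hd _ (by omega)
  | algebraMap r => exact hC r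
  | add x y _ _ hx hy => exact ha x y hx hy
  | mul x y _ _ hx hy => exact hm x y hx hy

end FaaDiBruno

namespace FaaDiBruno

variable {K : Type*} [Field K]

section Filtration

variable (K) in
/-- The span of the products `δ_{i_1} ⋯ δ_{i_l}` with `l ≥ m` and `i_1 + ⋯ + i_l = d`. -/
def deltaSpan (m d : ℕ) : Submodule K (FaaDiBruno K) :=
  Submodule.span K {f | ∃ s : Multiset ℕ, m ≤ s.card ∧ (∀ i ∈ s, 1 ≤ i) ∧ s.sum = d ∧
    f = (s.map (delta K)).prod}

theorem deltaSpan_anti {m m' : ℕ} (h : m ≤ m') (d : ℕ) : deltaSpan K m' d ≤ deltaSpan K m d :=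
  Submodule.span_mono fun _ ⟨s, h1, h2⟩ => ⟨s, h.trans h1, h2⟩

theorem one_mem_deltaSpan : (1 : FaaDiBruno K) ∈ deltaSpan K 0 0 :=
  Submodule.subset_span ⟨0, by simp⟩

theorem delta_mem_deltaSpan {n : ℕ} (hn : 1 ≤ n) : delta K n ∈ deltaSpan K 1 n :=
  Submodule.subset_span ⟨{n}, by simpa⟩

theorem mul_mem_deltaSpan {m m' d d' : ℕ} {f g : FaaDiBruno K} (hf : f ∈ deltaSpan K m d)
    (hg : g ∈ deltaSpan K m' d') : f * g ∈ deltaSpan K (m + m') (d + d') := by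
  have h := Submodule.mul_mem_mul hf hg
  rw [deltaSpan, deltaSpan, Submodule.span_mul_span] at h
  refine Submodule.span_mono ?_ h
  rintro _ ⟨_, ⟨s, h1, h2, h3, rfl⟩, _, ⟨t, h4, h5, h6, rfl⟩, rfl⟩
  refine ⟨s + t, by rw [Multiset.card_add]; omega, fun i hi => ?_, by simp [h3, h6], by simp⟩
  exact (Multiset.mem_add.mp hi).elim (h2 i) (h5 i)

variable (K) in
/-- The series whose coefficient of `t^d` lies in `deltaSpan K m d`. -/
def seriesSpan (m : ℕ) : Submodule K (PowerSeries (FaaDiBruno K)) where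
  carrier := {f | ∀ d, PowerSeries.coeff d f ∈ deltaSpan K m d}
  add_mem' hf hg d := by rw [map_add]; exact add_mem (hf d) (hg d)
  zero_mem' d := by rw [map_zero]; exact zero_mem _
  smul_mem' r f hf d := by
    exact Submodule.smul_mem _ r (hf d)

theorem seriesSpan_anti {m m' : ℕ} (h : m ≤ m') : seriesSpan K m' ≤ seriesSpan K m :=
  fun _ hf d => deltaSpan_anti h d (hf d)

theorem one_mem_seriesSpan : (1 : PowerSeries (FaaDiBruno K)) ∈ seriesSpan K 0 := fun d => by
  rw [PowerSeries.coeff_one]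
  split_ifs with h
  · subst h; exact one_mem_deltaSpan
  · exact zero_mem _

theorem mul_mem_seriesSpan {m m' : ℕ} {f g : PowerSeries (FaaDiBruno K)}
    (hf : f ∈ seriesSpan K m) (hg : g ∈ seriesSpan K m') : f * g ∈ seriesSpan K (m + m') :=
  fun d => by
    rw [PowerSeries.coeff_mul]
    refine sum_mem fun p hp => ?_
    rw [← Finset.HasAntidiagonal.mem_antidiagonal.mp hp]
    exact mul_mem_deltaSpan (hf _) (hg _)

theorem pow_mem_seriesSpan {f : PowerSeries (FaaDiBruno K)} (hf : f ∈ seriesSpan K 1) (k : ℕ) :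
    f ^ k ∈ seriesSpan K k := by
  induction k with
  | zero => rw [pow_zero]; exact one_mem_seriesSpan
  | succ k ih => rw [pow_succ]; exact mul_mem_seriesSpan ih hf

theorem expSeries_mem_seriesSpan {x : ℕ → FaaDiBruno K} {m : ℕ}
    (hx : ∀ n, 1 ≤ n → x n ∈ deltaSpan K m n) : expSeries K x ∈ seriesSpan K m := fun d => by
  rcases d with _ | d
  · rw [PowerSeries.coeff_zero_eq_constantCoeff_apply, constantCoeff_expSeries]
    exact zero_mem _
  · rw [coeff_expSeries _ (Nat.succ_ne_zero d)]
    exact Submodule.smul_mem _ _ (hx _ (by omega))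

theorem bellPoly_mem_deltaSpan {x : ℕ → FaaDiBruno K}
    (hx : ∀ n, 1 ≤ n → x n ∈ deltaSpan K 1 n) (n k : ℕ) : bellPoly K x n k ∈ deltaSpan K k n :=
  Submodule.smul_mem _ _ (pow_mem_seriesSpan (expSeries_mem_seriesSpan hx) k n)

theorem one_add_pow_sub_mem {Q : PowerSeries (FaaDiBruno K)} (hQ : Q ∈ seriesSpan K 1) (k : ℕ) :
    (1 + Q) ^ k - 1 - k • Q ∈ seriesSpan K 2 := by
  induction k with
  | zero => simp
  | succ k ih =>
    have h : (1 + Q) ^ (k + 1) - 1 - (k + 1) • Q =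
        ((1 + Q) ^ k - 1 - k • Q) + ((1 + Q) ^ k - 1 - k • Q) * Q +
          k • (Q * Q) := by
      rw [pow_succ, add_smul, one_smul, sub_mul, sub_mul, smul_mul_assoc]
      ring
    have h1 : ((1 + Q) ^ k - 1 - k • Q) * Q ∈ seriesSpan K 2 :=
      seriesSpan_anti (by omega) (mul_mem_seriesSpan ih hQ)
    have h2 : Q * Q ∈ seriesSpan K (1 + 1) := mul_mem_seriesSpan hQ hQ
    rw [h]
    exact add_mem (add_mem ih h1) (nsmul_mem h2 k)

theorem bellPoly_a_eq (n k : ℕ) (hkn : k ≤ n) :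
    bellPoly K (a K) n k = ((n ! : K) * (k ! : K)⁻¹) • PowerSeries.coeff (n - k)
      ((1 + PowerSeries.mk fun m => if m = 0 then 0 else (((m + 1)! : K)⁻¹) • a K (m + 1)) ^ k) := by
  have h : expSeries K (a K) = PowerSeries.X * (1 + PowerSeries.mk fun m =>
      if m = 0 then 0 else (((m + 1)! : K)⁻¹) • a K (m + 1)) := by
    ext m
    rcases m with _ | _ | m
    · simp [expSeries]
    · simp [PowerSeries.coeff_succ_X_mul, coeff_expSeries, a]
    · rw [PowerSeries.coeff_succ_X_mul, coeff_expSeries _ (by omega), map_add,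
        PowerSeries.coeff_one]
      simp
  rw [bellPoly, h, mul_pow, PowerSeries.coeff_X_pow_mul', if_pos hkn]

end Filtration

variable [CharZero K]

section Coproduct

variable {A : Type*} [CommRing A] [Algebra K A]

theorem derivative_series (f : FaaDiBruno K →ₐ[K] A) :
    PowerSeries.derivative A (expSeries K fun n => f (a K n)) =
      1 + expSeries K fun n => f (a K (n + 1)) := by
  have h : f (a K 1) = 1 := map_one f
  rw [derivative_expSeries, h, map_one]

theorem derivative_delta_series (f : FaaDiBruno K →ₐ[K] A) :
    PowerSeries.derivative A (expSeries K fun n => f (delta K n)) *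
        PowerSeries.derivative A (expSeries K fun n => f (a K n)) =
      PowerSeries.derivative A (PowerSeries.derivative A (expSeries K fun n => f (a K n))) := by
  rw [derivative_series, map_add, Derivation.map_one_eq_zero, zero_add]
  simp only [delta_eq_logSeq, map_logSeq]
  exact derivative_expSeries_logSeq _

/-- The series of the `δ_n` is the logarithmic derivative of a composition, hence a cocycle. -/
theorem delta_series_comul (f₁ f₂ : FaaDiBruno K →ₐ[K] A) :
    expSeries K (fun n => Algebra.TensorProduct.lift f₁ f₂ (fun _ _ => Commute.all _ _)
        (comulHom K (delta K n))) =
      expSeries K (fun n => f₁ (delta K n)) +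
        (expSeries K fun n => f₂ (delta K n)).subst (expSeries K fun n => f₁ (a K n)) := by
  set g := (Algebra.TensorProduct.lift f₁ f₂ (fun _ _ => Commute.all _ _)).comp (comulHom K)
    with hg
  have hc := series_comul f₁ f₂
  change expSeries K (fun n => g (a K n)) = _ at hc
  change expSeries K (fun n => g (delta K n)) = _
  have hs := hasSubst_expSeries (K := K) fun n => f₁ (a K n)
  have h := derivative_delta_series g
  have h1 := derivative_delta_series f₁
  have h2 := congrArg (PowerSeries.subst (expSeries K fun n => f₁ (a K n)))
    (derivative_delta_series f₂)
  rw [PowerSeries.subst_mul hs] at h2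
  refine PowerSeries.ext_derivative_of_algebra K ?_ ?_
  · have hu : IsUnit (PowerSeries.derivative A (expSeries K fun n => g (a K n))) := by
      rw [PowerSeries.isUnit_iff_constantCoeff, derivative_series, map_add, map_one,
        constantCoeff_expSeries, add_zero]
      exact isUnit_one
    refine hu.mul_right_cancel ?_
    rw [h, hc, map_add]
    simp only [PowerSeries.derivative_subst hs, Derivation.leibniz, smul_eq_mul]
    linear_combination (-(PowerSeries.subst (expSeries K fun n => f₁ (a K n))
        (PowerSeries.derivative A (expSeries K fun n => f₂ (a K n))))) * h1 -
      (PowerSeries.derivative A (expSeries K fun n => f₁ (a K n))) ^ 2 * h2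
  · rw [map_add, constantCoeff_expSeries, constantCoeff_expSeries, zero_add]
    exact (PowerSeries.constantCoeff_subst_eq_zero (constantCoeff_expSeries _) _
      (constantCoeff_expSeries _)).symm

theorem comul_delta {n : ℕ} (hn : 1 ≤ n) :
    CoalgebraStruct.comul (R := K) (delta K n) = delta K n ⊗ₜ[K] 1 +
      ∑ k ∈ Finset.Icc 1 n, bellPoly K (a K) n k ⊗ₜ[K] delta K k := by
  have h := congrArg (PowerSeries.coeff n) (delta_series_comul (K := K)
    Algebra.TensorProduct.includeLeft (Algebra.TensorProduct.includeRight :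
      FaaDiBruno K →ₐ[K] FaaDiBruno K ⊗[K] FaaDiBruno K))
  have hl : Algebra.TensorProduct.lift Algebra.TensorProduct.includeLeft
      (Algebra.TensorProduct.includeRight : FaaDiBruno K →ₐ[K] FaaDiBruno K ⊗[K] FaaDiBruno K)
      (fun _ _ => Commute.all _ _) = .id K _ := by
    refine Algebra.TensorProduct.ext ?_ ?_ <;> ext x <;> simp
  rw [map_add, coeff_subst_expSeries, coeff_expSeries _ (by omega), coeff_expSeries _ (by omega),
    ← smul_add] at h
  have h2 := smul_right_injective _
    (inv_ne_zero (by exact_mod_cast n.factorial_ne_zero : (n ! : K) ≠ 0)) h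
  rw [hl] at h2
  refine h2.trans ?_
  congr 1
  refine Finset.sum_congr rfl fun k _ => ?_
  rw [← map_bellPoly]
  simp

end Coproduct

section LinearPart

theorem bellPoly_one {A : Type*} [CommRing A] [Algebra K A] (x : ℕ → A) {n : ℕ} (hn : 1 ≤ n) :
    bellPoly K x n 1 = x n := by
  rw [bellPoly, pow_one, coeff_expSeries _ (by omega), smul_smul, Nat.factorial_one, Nat.cast_one,
    inv_one, mul_one, mul_inv_cancel₀ (by exact_mod_cast n.factorial_ne_zero), one_smul]

/-- `a_{n+1}` is `δ_n` up to products of at least two generators. -/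
theorem a_sub_delta_mem {n : ℕ} (hn : 1 ≤ n) : a K (n + 1) - delta K n ∈ deltaSpan K 2 n := by
  rw [a_eq_expSeq_delta (by omega), expSeq, ← Finset.add_sum_Ioc_eq_sum_Icc hn, bellPoly_one _ hn,
    add_sub_cancel_left]
  exact sum_mem fun k hk => deltaSpan_anti (by have := Finset.mem_Ioc.mp hk; omega) _
    (bellPoly_mem_deltaSpan (fun _ => delta_mem_deltaSpan) n k)

theorem a_mem_deltaSpan {n : ℕ} (hn : 1 ≤ n) : a K (n + 1) ∈ deltaSpan K 1 n := by
  have := add_mem (deltaSpan_anti one_le_two _ (a_sub_delta_mem (K := K) hn))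
    (delta_mem_deltaSpan hn)
  rwa [sub_add_cancel] at this

theorem bellPoly_a_self (n : ℕ) : bellPoly K (a K) n n = 1 := by
  rw [bellPoly_a_eq n n le_rfl, Nat.sub_self, PowerSeries.coeff_zero_eq_constantCoeff_apply,
    map_pow, map_add, map_one, ← PowerSeries.coeff_zero_eq_constantCoeff_apply,
    PowerSeries.coeff_mk, if_pos rfl, add_zero, one_pow,
    mul_inv_cancel₀ (by exact_mod_cast n.factorial_ne_zero), one_smul]

/-- The linear part of `B_{n,k}(a_1, a_2, …)` in the coordinates `δ_i`. -/
theorem bellPoly_a_sub_mem {n k : ℕ} (hk : 1 ≤ k) (hkn : k < n) :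
    bellPoly K (a K) n k - (n.choose (k - 1) : K) • delta K (n - k) ∈
      deltaSpan K 2 (n - k) := by
  set Q : PowerSeries (FaaDiBruno K) :=
    PowerSeries.mk fun m => if m = 0 then 0 else (((m + 1)! : K)⁻¹) • a K (m + 1) with hQ
  have hQ1 : Q ∈ seriesSpan K 1 := fun d => by
    rw [hQ, PowerSeries.coeff_mk]
    split_ifs with h
    · exact zero_mem _
    · exact Submodule.smul_mem _ _ (a_mem_deltaSpan (by omega))
  have h := one_add_pow_sub_mem hQ1 k (n - k)
  have hQc : PowerSeries.coeff (n - k) Q = (((n - k + 1)! : K)⁻¹) • a K (n - k + 1) := by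
    rw [hQ, PowerSeries.coeff_mk, if_neg (by omega)]
  rw [map_sub, map_sub, PowerSeries.coeff_one, if_neg (by omega), sub_zero,
    map_nsmul, hQc, ← Nat.cast_smul_eq_nsmul K] at h
  have hc : (n ! : K) * (k ! : K)⁻¹ * (k * ((n - k + 1)! : K)⁻¹) = n.choose (k - 1) := by
    obtain ⟨k, rfl⟩ := Nat.exists_eq_add_of_le' hk
    rw [Nat.add_sub_cancel, Nat.cast_choose K (by omega),
      show n - (k + 1) + 1 = n - k by omega, Nat.factorial_succ, Nat.cast_mul]
    have h1 : ((k + 1 : ℕ) : K) ≠ 0 := by exact_mod_cast Nat.succ_ne_zero k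
    have h2 : (k ! : K) ≠ 0 := by exact_mod_cast k.factorial_ne_zero
    have h3 : ((n - k)! : K) ≠ 0 := by exact_mod_cast (n - k).factorial_ne_zero
    field_simp
  have h2 := add_mem (Submodule.smul_mem _ ((n ! : K) * (k ! : K)⁻¹) h)
    (Submodule.smul_mem _ (n.choose (k - 1) : K) (a_sub_delta_mem (K := K) (n := n - k) (by omega)))
  rw [bellPoly_a_eq n k hkn.le]
  convert h2 using 1
  rw [smul_sub, smul_sub, smul_smul, smul_smul, mul_assoc, hc]
  abel

theorem comul_delta_sub_mem_higherTerms {n : ℕ} (hn : 1 ≤ n) :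
    CoalgebraStruct.comul (R := K) (delta K n) - (delta K n ⊗ₜ[K] 1 + 1 ⊗ₜ[K] delta K n +
      ∑ i ∈ Finset.Icc 1 (n - 1), (n.choose (i - 1)) • (delta K (n - i) ⊗ₜ[K] delta K i)) ∈
        higherTerms K n := by
  have h : Finset.Icc 1 n = insert n (Finset.Icc 1 (n - 1)) := by
    ext i; simp; omega
  rw [comul_delta hn, h, Finset.sum_insert (by simp; omega), bellPoly_a_self,
    ← add_assoc, add_sub_add_left_eq_sub, ← Finset.sum_sub_distrib]
  refine sum_mem fun i hi => ?_
  obtain ⟨h1, h2⟩ := Finset.mem_Icc.mp hi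
  rw [← Nat.cast_smul_eq_nsmul K, TensorProduct.smul_tmul', ← TensorProduct.sub_tmul]
  have hm := bellPoly_a_sub_mem (K := K) h1 (show i < n by omega)
  generalize bellPoly K (a K) n i - (n.choose (i - 1) : K) • delta K (n - i) = f at hm
  induction hm using Submodule.span_induction with
  | mem x hx =>
    obtain ⟨s, hs1, hs2, hs3, rfl⟩ := hx
    exact Submodule.subset_span ⟨s, i, hs1, hs2, h1, by omega, rfl⟩
  | zero => rw [TensorProduct.zero_tmul]; exact zero_mem _
  | add x y _ _ hx hy => rw [TensorProduct.add_tmul]; exact add_mem hx hy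
  | smul r x _ hx => rw [← TensorProduct.smul_tmul']; exact Submodule.smul_mem _ r hx

end LinearPart

end FaaDiBruno

theorem MvPolynomial.coeff_single_one_mul {σ R : Type*} [CommSemiring R] (i : σ)
    (f g : MvPolynomial σ R) :
    (f * g).coeff (Finsupp.single i 1) =
      f.coeff (Finsupp.single i 1) * g.coeff 0 + f.coeff 0 * g.coeff (Finsupp.single i 1) := by
  classical
  rw [MvPolynomial.coeff_mul, Finsupp.antidiagonal_single, Finset.sum_map,
    Finset.Nat.antidiagonal_succ]
  simp [add_comm]

namespace FaaDiBruno

variable {K : Type*} [Field K]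

theorem counitHom_apply (f : FaaDiBruno K) :
    counitHom K f = MvPolynomial.coeff 0 (f : MvPolynomial ℕ K) := by
  have h : (counitHom K : FaaDiBruno K →ₐ[K] K) =
      (MvPolynomial.aeval (fun _ => 0) : MvPolynomial ℕ K →ₐ[K] K) := rfl
  rw [h]
  exact MvPolynomial.aeval_zero' _

theorem aDual_mul (n : ℕ) (f g : FaaDiBruno K) :
    aDual K n (f * g) = aDual K n f * counitHom K g + counitHom K f * aDual K n g := by
  rw [counitHom_apply, counitHom_apply]
  exact MvPolynomial.coeff_single_one_mul (n - 2) (f : MvPolynomial ℕ K) g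

theorem bDual_apply (n : ℕ) (f : FaaDiBruno K) :
    (bDual K n).ofConv f = ((n + 1)! : K) * aDual K (n + 1) f := rfl

theorem bDual_mul (n : ℕ) (f g : FaaDiBruno K) :
    (bDual K n).ofConv (f * g) =
      (bDual K n).ofConv f * counitHom K g + counitHom K f * (bDual K n).ofConv g := by
  simp only [bDual_apply, aDual_mul]; ring

theorem bDual_one (n : ℕ) : (bDual K n).ofConv 1 = 0 := by
  have h := bDual_mul (K := K) n 1 1
  rw [mul_one, map_one (counitHom K), mul_one, one_mul] at h
  exact left_eq_add.mp h

theorem bDual_a {n m : ℕ} (hn : 1 ≤ n) (hm : 1 ≤ m) :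
    (bDual K n).ofConv (a K (m + 1)) = if m = n then ((n + 1)! : K) else 0 := by
  obtain ⟨n, rfl⟩ := Nat.exists_eq_add_of_le' hn
  obtain ⟨m, rfl⟩ := Nat.exists_eq_add_of_le' hm
  have h : aDual K (n + 1 + 1) (a K (m + 1 + 1)) =
      MvPolynomial.coeff (Finsupp.single n 1) (MvPolynomial.X m : MvPolynomial ℕ K) := rfl
  rw [bDual_apply, h, MvPolynomial.coeff_X, mul_ite, mul_one, mul_zero]
  simp [Finsupp.single_left_inj]

theorem counitHom_delta (n : ℕ) : counitHom K (delta K n) = 0 := by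
  rw [delta_eq_logSeq, map_logSeq, logSeq_congr (y := 0), logSeq]
  · refine Finset.sum_eq_zero fun k hk => ?_
    have h : expSeries K (0 : ℕ → K) = 0 := by ext n; simp [expSeries]
    have hk : k ≠ 0 := by have := Finset.mem_Icc.mp hk; omega
    rw [bellPoly, h, zero_pow hk, map_zero, smul_zero, smul_zero]
  · rintro (_ | n) hn
    · exact absurd rfl hn
    · exact evalHom_a _ n

theorem bDual_eq_zero_of_mem {n d : ℕ} {f : FaaDiBruno K} (hf : f ∈ deltaSpan K 2 d) :
    (bDual K n).ofConv f = 0 := by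
  induction hf using Submodule.span_induction with
  | mem x hx =>
    obtain ⟨s, h2, -, -, rfl⟩ := hx
    obtain ⟨i, hi⟩ := Multiset.card_pos_iff_exists_mem.mp (show 0 < s.card by omega)
    obtain ⟨t, rfl⟩ := Multiset.exists_cons_of_mem hi
    rw [Multiset.card_cons] at h2
    obtain ⟨j, hj⟩ := Multiset.card_pos_iff_exists_mem.mp (show 0 < t.card by omega)
    obtain ⟨t, rfl⟩ := Multiset.exists_cons_of_mem hj
    rw [Multiset.map_cons, Multiset.prod_cons, Multiset.map_cons, Multiset.prod_cons, bDual_mul,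
      map_mul, counitHom_delta, counitHom_delta]
    simp
  | zero => exact map_zero _
  | add x y _ _ hx hy => rw [map_add, hx, hy, add_zero]
  | smul r x _ hx => rw [map_smul, hx, smul_zero]

variable [CharZero K]

theorem bDual_delta {n m : ℕ} (hn : 1 ≤ n) (hm : 1 ≤ m) :
    (bDual K n).ofConv (delta K m) = if m = n then ((n + 1)! : K) else 0 := by
  rw [← bDual_a hn hm]
  have h := bDual_eq_zero_of_mem (n := n) (a_sub_delta_mem (K := K) hm)
  rw [map_sub, sub_eq_zero] at h
  exact h.symm

/-- The operator `f ↦ (b ⊗ id) (Δ f)`. -/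
def contractLeft (b : FaaDiBruno K →ₗ[K] K) : FaaDiBruno K →ₗ[K] FaaDiBruno K :=
  (TensorProduct.lid K (FaaDiBruno K)).toLinearMap ∘ₗ b.rTensor (FaaDiBruno K) ∘ₗ
    CoalgebraStruct.comul

theorem convMul_apply_eq (b c : WithConv (FaaDiBruno K →ₗ[K] K)) (f : FaaDiBruno K) :
    (b * c) f = c (contractLeft b.ofConv f) := by
  rw [LinearMap.convMul_apply]
  change _ = c.ofConv _
  simp only [contractLeft, LinearMap.comp_apply]
  induction CoalgebraStruct.comul (R := K) f with
  | zero => simp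
  | add x y hx hy => simp only [map_add, hx, hy]
  | tmul x y => simp

theorem contractLeft_mul {b : FaaDiBruno K →ₗ[K] K}
    (hb : ∀ f g, b (f * g) = b f * counitHom K g + counitHom K f * b g) (f g : FaaDiBruno K) :
    contractLeft b (f * g) = contractLeft b f * g + f * contractLeft b g := by
  have h : ∀ z w : FaaDiBruno K ⊗[K] FaaDiBruno K,
      TensorProduct.lid K _ (b.rTensor _ (z * w)) =
        TensorProduct.lid K _ (b.rTensor _ z) *
            TensorProduct.lid K _ ((counitHom K).toLinearMap.rTensor _ w) +
          TensorProduct.lid K _ ((counitHom K).toLinearMap.rTensor _ z) *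
            TensorProduct.lid K _ (b.rTensor _ w) := by
    intro z w
    induction z with
    | zero => simp
    | add x y hx hy => simp only [add_mul, map_add, hx, hy]; abel
    | tmul x y =>
      induction w with
      | zero => simp
      | add x y hx hy => simp only [mul_add, map_add, hx, hy]; abel
      | tmul x' y' =>
        simp only [Algebra.TensorProduct.tmul_mul_tmul, LinearMap.rTensor_tmul,
          TensorProduct.lid_tmul, hb, add_smul, AlgHom.toLinearMap_apply, smul_mul_smul_comm]
  have hc : ∀ f : FaaDiBruno K, TensorProduct.lid K _
      ((counitHom K).toLinearMap.rTensor _ (CoalgebraStruct.comul (R := K) f)) = f := by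
    intro f
    have := Coalgebra.rTensor_counit_comul (R := K) f
    refine (congrArg (TensorProduct.lid K (FaaDiBruno K)) this).trans ?_
    simp
  simp only [contractLeft, LinearMap.comp_apply, LinearEquiv.coe_coe, Bialgebra.comul_mul]
  rw [h, hc, hc]

variable (K) in
/-- The derivation `(b'_c ⊗ id) Δ`. -/
def leftDer (c : ℕ) : FaaDiBruno K →ₗ[K] FaaDiBruno K := contractLeft (bDual K c).ofConv

theorem leftDer_mul (c : ℕ) (f g : FaaDiBruno K) :
    leftDer K c (f * g) = leftDer K c f * g + f * leftDer K c g :=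
  contractLeft_mul (bDual_mul c) f g

theorem leftDer_one (c : ℕ) : leftDer K c 1 = 0 := by
  have h := leftDer_mul (K := K) c 1 1
  rw [mul_one, mul_one, one_mul] at h
  exact left_eq_add.mp h

theorem leftDer_algebraMap (c : ℕ) (r : K) : leftDer K c (algebraMap K _ r) = 0 := by
  rw [Algebra.algebraMap_eq_smul_one, map_smul, leftDer_one, smul_zero]

theorem leftDer_delta {c n : ℕ} (hc : 1 ≤ c) (hn : 1 ≤ n) :
    leftDer K c (delta K n) = if n = c then ((c + 1)! : K) • 1 else
      if c < n then (n ! * ((n - c - 1)! : K)⁻¹) • delta K (n - c) else 0 := by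
  have h : Finset.Icc 1 n = insert n (Finset.Icc 1 (n - 1)) := by
    ext i; simp; omega
  have hb : ∀ k ∈ Finset.Icc 1 (n - 1), (bDual K c).ofConv (bellPoly K (a K) n k) • delta K k =
      if k = n - c then ((n.choose (n - c - 1) : K) * (c + 1)!) • delta K (n - c) else 0 := by
    intro k hk
    obtain ⟨h1, h2⟩ := Finset.mem_Icc.mp hk
    have h3 := bDual_eq_zero_of_mem (n := c) (bellPoly_a_sub_mem (K := K) h1 (show k < n by omega))
    rw [map_sub, sub_eq_zero] at h3
    rw [h3, map_smul, bDual_delta hc (by omega)]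
    by_cases h4 : n - k = c
    · rw [if_pos h4, if_pos (by omega), smul_eq_mul, show n - c = k by omega]
    · rw [if_neg h4, if_neg (by omega), smul_zero, zero_smul]
  simp only [leftDer, contractLeft, LinearMap.comp_apply, comul_delta hn, map_add, map_sum,
    LinearMap.rTensor_tmul, LinearEquiv.coe_coe, TensorProduct.lid_tmul]
  rw [h, Finset.sum_insert (by simp; omega), Finset.sum_congr rfl hb, bellPoly_a_self, bDual_one,
    zero_smul, zero_add, Finset.sum_ite_eq', bDual_delta hc hn]
  by_cases h1 : n = c
  · rw [if_pos h1, if_pos h1, if_neg (by simp; omega), add_zero]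
  · rw [if_neg h1, if_neg h1, zero_smul, zero_add]
    by_cases h2 : c < n
    · rw [if_pos (by simp; omega), if_pos h2, Nat.cast_choose K (by omega),
        show n - (n - c - 1) = c + 1 by omega]
      congr 1
      have h3 : ((c + 1)! : K) ≠ 0 := by exact_mod_cast (c + 1).factorial_ne_zero
      field_simp
    · rw [if_neg (by simp; omega), if_neg h2]

end FaaDiBruno

/-! ### Removing letters -/

namespace ShuffleAlgebra

variable {K : Type*} [Field K]

/-- `u^{c w} ↦ u^w`, and the other words go to `0`. -/
def removeLeft (c : ℕ+) : ShuffleAlgebra K →ₗ[K] ShuffleAlgebra K :=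
  (basis K).constr K fun
    | [] => 0
    | d :: w => if d = c then u K w else 0

theorem removeLeft_one (c : ℕ+) : removeLeft c (1 : ShuffleAlgebra K) = 0 :=
  (basis K).constr_basis K _ []

theorem removeLeft_u_cons (c d : ℕ+) (w : List ℕ+) :
    removeLeft c (u K (d :: w)) = if d = c then u K w else 0 :=
  (basis K).constr_basis K _ (d :: w)

theorem removeLeft_prepend (c d : ℕ+) (x : ShuffleAlgebra K) :
    removeLeft c (prepend K d x) = if d = c then x else 0 := by
  have h : removeLeft c ∘ₗ prepend K d = if d = c then LinearMap.id else 0 := by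
    refine (basis K).ext fun w => ?_
    rw [LinearMap.comp_apply, basis_eq, prepend_u, removeLeft_u_cons]
    split_ifs <;> simp
  have h1 := congrArg (fun f => f x) h
  simp only [LinearMap.comp_apply] at h1
  rw [h1]
  split_ifs <;> simp

theorem removeLeft_mul (c : ℕ+) (x y : ShuffleAlgebra K) :
    removeLeft c (x * y) = removeLeft c x * y + x * removeLeft c y := by
  have h : (mulLin K).compr₂ (removeLeft c) =
      (mulLin K).comp (removeLeft c) + (mulLin K).compl₂ (removeLeft c) := by
    refine (basis K).ext fun v => (basis K).ext fun w => ?_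
    change removeLeft c (u K v * u K w) =
      removeLeft c (u K v) * u K w + u K v * removeLeft c (u K w)
    rcases v with _ | ⟨a, v⟩
    · rw [← one_def, one_mul, removeLeft_one, zero_mul, zero_add, one_mul]
    rcases w with _ | ⟨b, w⟩
    · rw [← one_def, mul_one, removeLeft_one, mul_zero, add_zero, mul_one]
    rw [u_cons_mul_u_cons, map_add, removeLeft_prepend, removeLeft_prepend, removeLeft_u_cons,
      removeLeft_u_cons]
    split_ifs <;> simp
  exact congrArg (fun f => f x y) h

theorem coord_u [DecidableEq (List ℕ+)] (v w : List ℕ+) :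
    (basis K).coord v (u K w) = if w = v then 1 else 0 := by
  rw [← basis_eq, Module.Basis.coord_apply, Module.Basis.repr_self, Finsupp.single_apply]

theorem coord_removeLeft (c : ℕ+) (w : List ℕ+) (x : ShuffleAlgebra K) :
    (basis K).coord w (removeLeft c x) = (basis K).coord (c :: w) x := by
  classical
  have h : (basis K).coord w ∘ₗ removeLeft c = (basis K).coord (c :: w) := by
    refine (basis K).ext fun v => ?_
    rw [LinearMap.comp_apply, basis_eq, coord_u]
    rcases v with _ | ⟨d, v⟩
    · rw [← one_def, removeLeft_one, map_zero, if_neg (by simp)]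
    · rw [removeLeft_u_cons]
      by_cases h : d = c
      · rw [if_pos h, coord_u, h]; simp
      · rw [if_neg h, map_zero, if_neg (by simp [h])]
  exact congrArg (fun f => f x) h

theorem ext_coord {x y : ShuffleAlgebra K}
    (h : ∀ w, (basis K).coord w x = (basis K).coord w y) : x = y :=
  (basis K).ext_elem h

/-- The sum of the letters of a word. -/
def weight (w : List ℕ+) : ℕ := (w.map ((↑) : ℕ+ → ℕ)).sum

@[simp] theorem weight_nil : weight [] = 0 := rfl

@[simp] theorem weight_cons (c : ℕ+) (w : List ℕ+) : weight (c :: w) = c + weight w := by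
  simp [weight]

theorem weight_eq_zero {w : List ℕ+} (h : weight w = 0) : w = [] := by
  rcases w with _ | ⟨c, w⟩
  · rfl
  · rw [weight_cons] at h; have := c.pos; omega

variable (K) in
/-- `Γ_n = n! ∑ C^w u^w`, over the words `w` of weight `n`. -/
def gamma (n : ℕ) : ShuffleAlgebra K :=
  (n ! : K) • ∑ c : Composition n, (wordCoeff c.blocks : K) • u K c.toWord

theorem map_toWord {n : ℕ} (c : Composition n) : c.toWord.map ((↑) : ℕ+ → ℕ) = c.blocks :=
  List.map_ofFn.trans c.ofFn_blocksFun

theorem coord_gamma (n : ℕ) (w : List ℕ+) : (basis K).coord w (gamma K n) =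
    if weight w = n then (n ! : K) * wordCoeff (w.map ((↑) : ℕ+ → ℕ)) else 0 := by
  classical
  rw [gamma, map_smul, map_sum]
  simp only [map_smul, coord_u, smul_eq_mul]
  split_ifs with h
  · let c₀ : Composition n := ⟨w.map ((↑) : ℕ+ → ℕ), by simp, h⟩
    have hc₀ : c₀.toWord = w :=
      List.map_injective_iff.mpr PNat.coe_injective (map_toWord c₀)
    rw [Finset.sum_eq_single c₀, if_pos hc₀, mul_one]
    · intro c _ hc
      rw [if_neg, mul_zero]
      intro h1
      refine hc (Composition.ext ?_)
      rw [← map_toWord c, h1]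
    · simp
  · rw [Finset.sum_eq_zero, mul_zero]
    intro c _
    rw [if_neg, mul_zero]
    rintro rfl
    exact h (by rw [weight, map_toWord, c.blocks_sum])

theorem wordCoeff_singleton (c : ℕ) : wordCoeff [c] = c + 1 := by
  simp [wordCoeff]

theorem wordCoeff_cons (c : ℕ) {l : List ℕ} (hl : l ≠ []) :
    wordCoeff (c :: l) = l.sum * wordCoeff l := by
  obtain ⟨d, l, rfl⟩ := List.exists_cons_of_ne_nil hl
  have h1 : (c :: d :: l).getLastD 0 = (d :: l).getLastD 0 := by simp
  have h2 : Finset.Icc 2 (c :: d :: l).length =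
      insert 2 ((Finset.Icc 2 (d :: l).length).map (addRightEmbedding 1)) := by
    ext i
    simp
    omega
  rw [wordCoeff, wordCoeff, h1, h2, Finset.prod_insert (by simp), Finset.prod_map]
  have h3 : ∀ i ∈ Finset.Icc 2 (d :: l).length,
      ((c :: d :: l).drop (addRightEmbedding 1 i - 1)).sum = ((d :: l).drop (i - 1)).sum := by
    intro i hi
    obtain ⟨i, rfl⟩ := Nat.exists_eq_add_of_le' (Finset.mem_Icc.mp hi).1
    rfl
  rw [Finset.prod_congr rfl h3]
  simp only [show (2 : ℕ) - 1 = 1 from rfl, List.drop_succ_cons, List.drop_zero]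
  ring

variable [CharZero K]

theorem removeLeft_gamma (c : ℕ+) (n : ℕ) :
    removeLeft c (gamma K n) = if n = c then ((c + 1 : ℕ)! : K) • 1 else
      if c < n then (n ! * ((n - c - 1)! : K)⁻¹) • gamma K (n - c) else 0 := by
  classical
  refine ext_coord fun w => ?_
  rw [coord_removeLeft, coord_gamma, weight_cons, List.map_cons]
  by_cases h1 : n = c
  · rw [if_pos h1, map_smul, one_def, coord_u, smul_eq_mul]
    by_cases h2 : w = []
    · subst h2
      rw [if_pos (by simp [h1]), if_pos rfl, List.map_nil, wordCoeff_singleton, h1,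
        Nat.factorial_succ]
      push_cast; ring
    · rw [if_neg, if_neg (Ne.symm h2), mul_zero]
      intro h3
      exact h2 (weight_eq_zero (by omega))
  · rw [if_neg h1]
    by_cases h2 : (c : ℕ) < n
    · rw [if_pos h2, map_smul, coord_gamma, smul_eq_mul]
      by_cases h3 : weight w = n - c
      · rw [if_pos (by omega), if_pos h3, wordCoeff_cons]
        · have h4 : (w.map ((↑) : ℕ+ → ℕ)).sum = n - c - 1 + 1 := by
            have : (w.map ((↑) : ℕ+ → ℕ)).sum = n - c := h3
            omega
          have h5 : n - (c : ℕ) = n - c - 1 + 1 := by omega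
          rw [h4, h5, Nat.add_sub_cancel, Nat.factorial_succ]
          have h6 : ((n - (c : ℕ) - 1)! : K) ≠ 0 := by exact_mod_cast Nat.factorial_ne_zero _
          push_cast
          field_simp
        · rintro h
          rw [weight, h] at h3
          simp at h3; omega
      · rw [if_neg (by omega), if_neg h3, mul_zero]
    · rw [if_neg h2, if_neg (by omega), map_zero]

end ShuffleAlgebra

section Pairing

variable {K : Type*} [Field K]

theorem wordBasis_nil : wordBasis K [] = 1 := by rw [wordBasis_apply]; rfl

theorem wordBasis_cons (c : ℕ+) (w : List ℕ+) :
    wordBasis K (c :: w) = genX K c * wordBasis K w := by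
  rw [wordBasis_apply, wordBasis_apply, List.map_cons, List.prod_cons]

theorem wordBasis_append (v w : List ℕ+) :
    wordBasis K (v ++ w) = wordBasis K v * wordBasis K w := by
  rw [wordBasis_apply, wordBasis_apply, wordBasis_apply, List.map_append, List.prod_append]

theorem FreeEnveloping.word_induction {p : FreeEnveloping K → Prop}
    (hw : ∀ w, p (wordBasis K w)) (h0 : p 0) (ha : ∀ x y, p x → p y → p (x + y))
    (hs : ∀ (r : K) x, p x → p (r • x)) (x : FreeEnveloping K) : p x := by
  have hx : x ∈ Submodule.span K (Set.range (wordBasis K)) := by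
    rw [(wordBasis K).span_eq]; trivial
  induction hx using Submodule.span_induction with
  | mem x h => obtain ⟨w, rfl⟩ := h; exact hw w
  | zero => exact h0
  | add x y _ _ hx hy => exact ha x y hx hy
  | smul r x _ hx => exact hs r x hx

theorem pairing_wordBasis (h : ShuffleAlgebra K) (w : List ℕ+) :
    pairing K h (wordBasis K w) = (ShuffleAlgebra.basis K).coord w h := by
  classical
  have h1 : (LinearMap.applyₗ (wordBasis K w)).comp (pairing K) =
      (ShuffleAlgebra.basis K).coord w := by
    refine (ShuffleAlgebra.basis K).ext fun v => ?_
    rw [LinearMap.comp_apply, pairing, Module.Basis.constr_basis, LinearMap.applyₗ_apply_apply,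
      Module.Basis.coord_apply, Module.Basis.coord_apply, Module.Basis.repr_self,
      Module.Basis.repr_self, Finsupp.single_apply, Finsupp.single_apply]
    simp only [eq_comm]
  exact congrArg (fun f => f h) h1

end Pairing

namespace ShuffleAlgebra

variable {K : Type*} [Field K]

theorem coord_nil (x : ShuffleAlgebra K) : (basis K).coord [] x = Coalgebra.counit (R := K) x := rfl

/-- The tensor product of two coordinate functionals. -/
def coordTensor (v w : List ℕ+) : ShuffleAlgebra K ⊗[K] ShuffleAlgebra K →ₗ[K] K :=
  LinearMap.mul' K K ∘ₗ TensorProduct.map ((basis K).coord v) ((basis K).coord w)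

theorem coordTensor_tmul (v w : List ℕ+) (x y : ShuffleAlgebra K) :
    coordTensor v w (x ⊗ₜ y) = (basis K).coord v x * (basis K).coord w y := rfl

theorem ext_coordTensor {z z' : ShuffleAlgebra K ⊗[K] ShuffleAlgebra K}
    (h : ∀ v w, coordTensor v w z = coordTensor v w z') : z = z' := by
  have h1 : ∀ v w (z : ShuffleAlgebra K ⊗[K] ShuffleAlgebra K),
      ((basis K).tensorProduct (basis K)).repr z (v, w) = coordTensor v w z := by
    intro v w z
    induction z with
    | zero => simp
    | add x y hx hy => rw [map_add, map_add, Finsupp.add_apply, hx, hy]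
    | tmul x y =>
      rw [Module.Basis.tensorProduct_repr_tmul_apply, coordTensor_tmul, smul_eq_mul, mul_comm]
      rfl
  refine ((basis K).tensorProduct (basis K)).ext_elem fun p => ?_
  rw [← Prod.mk.eta (p := p), h1, h1, h]

theorem rTensor_removeLeft_comul (c : ℕ+) (x : ShuffleAlgebra K) :
    (removeLeft c).rTensor _ (comulLin K x) = comulLin K (removeLeft c x) := by
  have h : (removeLeft c).rTensor _ ∘ₗ comulLin K = comulLin K ∘ₗ removeLeft c := by
    refine linearMap_ext ?_ fun d w _ => ?_
    · simp [comulLin_one, removeLeft_one]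
    · rw [LinearMap.comp_apply, LinearMap.comp_apply, comulLin_prepend, map_add,
        LinearMap.rTensor_tmul, removeLeft_one, TensorProduct.zero_tmul, zero_add,
        removeLeft_prepend, ← LinearMap.rTensor_comp_apply]
      have h1 : removeLeft c ∘ₗ prepend K d = if d = c then LinearMap.id else 0 := by
        refine LinearMap.ext fun x => ?_
        rw [LinearMap.comp_apply, removeLeft_prepend]
        split_ifs <;> rfl
      rw [h1]
      split_ifs <;> simp
  exact congrArg (fun f => f x) h

theorem coordTensor_comul (v w : List ℕ+) (x : ShuffleAlgebra K) :
    coordTensor v w (CoalgebraStruct.comul (R := K) x) = (basis K).coord (v ++ w) x := by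
  induction v generalizing x with
  | nil =>
    have h : coordTensor (K := K) [] w = (basis K).coord w ∘ₗ (TensorProduct.lid K _).toLinearMap ∘ₗ
        (CoalgebraStruct.counit (R := K)).rTensor (ShuffleAlgebra K) := by
      refine TensorProduct.ext' fun x y => ?_
      rw [coordTensor_tmul, coord_nil]
      simp
    rw [h, LinearMap.comp_apply, LinearMap.comp_apply, Coalgebra.rTensor_counit_comul]
    simp
  | cons c v ih =>
    have h : coordTensor (K := K) (c :: v) w =
        coordTensor v w ∘ₗ (removeLeft c).rTensor (ShuffleAlgebra K) := by
      refine TensorProduct.ext' fun x y => ?_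
      rw [LinearMap.comp_apply, LinearMap.rTensor_tmul, coordTensor_tmul, coordTensor_tmul,
        coord_removeLeft]
    rw [h, LinearMap.comp_apply, List.cons_append, ← coord_removeLeft, ← ih]
    exact congrArg _ (rTensor_removeLeft_comul c x)

end ShuffleAlgebra

/-- Bialgebra morphisms between Hopf algebras commute with the antipodes. -/
theorem BialgHom.apply_antipode {R A B : Type*} [CommSemiring R] [Semiring A] [Semiring B]
    [HopfAlgebra R A] [HopfAlgebra R B] (f : A →ₐc[R] B) (x : A) :
    f (HopfAlgebra.antipode R x) = HopfAlgebra.antipode R (f x) := by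
  have h1 : WithConv.toConv ((f : A →ₐ[R] B).toLinearMap ∘ₗ HopfAlgebra.antipode R) *
      WithConv.toConv (f : A →ₐ[R] B).toLinearMap = 1 := by
    have h := LinearMap.algHom_comp_convMul_distrib (f : A →ₐ[R] B)
      (WithConv.toConv (HopfAlgebra.antipode R (A := A))) (WithConv.toConv LinearMap.id)
    rw [LinearMap.antipode_mul_id] at h
    refine (congrArg WithConv.toConv h).symm.trans (WithConv.ext (LinearMap.ext fun y => ?_))
    exact (f : A →ₐ[R] B).commutes _
  have h2 : WithConv.toConv (f : A →ₐ[R] B).toLinearMap *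
      WithConv.toConv (HopfAlgebra.antipode R ∘ₗ (f : A →ₐ[R] B).toLinearMap) = 1 := by
    have h := LinearMap.convMul_comp_coalgHom_distrib
      (WithConv.toConv LinearMap.id) (WithConv.toConv (HopfAlgebra.antipode R (A := B)))
      (f : A →ₗc[R] B)
    rw [LinearMap.id_mul_antipode] at h
    refine (congrArg WithConv.toConv h).symm.trans (WithConv.ext (LinearMap.ext fun y => ?_))
    exact congrArg (algebraMap R B) (CoalgHomClass.counit_comp_apply f y)
  exact congrArg (fun g => g.ofConv x) (left_inv_eq_right_inv h1 h2)

namespace FreeEnveloping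

attribute [local instance] LieRing.ofAssociativeRing

variable {K : Type*} [Field K]

theorem comulHom_genX (c : ℕ+) :
    FreeEnveloping.comulHom K (genX K c) = genX K c ⊗ₜ[K] 1 + 1 ⊗ₜ[K] genX K c := by
  rw [FreeEnveloping.comulHom, genX, UniversalEnvelopingAlgebra.lift_ι_apply,
    FreeLieAlgebra.lift_of_apply]
  rfl

theorem counitHom_genX (c : ℕ+) :
    FreeEnveloping.counitHom K (genX K c) = 0 := by
  rw [FreeEnveloping.counitHom, genX, UniversalEnvelopingAlgebra.lift_ι_apply,
    FreeLieAlgebra.lift_of_apply]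

end FreeEnveloping

namespace FaaDiBruno

open ShuffleAlgebra

variable {K : Type*} [Field K]

theorem evalTensor_tmul (f g : FaaDiBruno K) (b c : WithConv (FaaDiBruno K →ₗ[K] K)) :
    evalTensor K f g (b ⊗ₜ c) = b f * c g := rfl

variable [CharZero K]

section

attribute [local instance] LieRing.ofAssociativeRing

theorem rho_genX (c : ℕ+) : rho K (genX K c) = bDual K c := by
  rw [rho, genX, UniversalEnvelopingAlgebra.lift_ι_apply, FreeLieAlgebra.lift_of_apply]

end

theorem rho_one_apply (f : FaaDiBruno K) : rho K 1 f = counitHom K f := by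
  rw [map_one]; rfl

theorem rho_genX_mul (c : ℕ+) (x : FreeEnveloping K) (f : FaaDiBruno K) :
    rho K (genX K c * x) f = rho K x (leftDer K c f) := by
  rw [map_mul, rho_genX, convMul_apply_eq]; rfl

theorem rho_apply_one (x : FreeEnveloping K) : rho K x 1 = FreeEnveloping.counitHom K x := by
  induction x using FreeEnveloping.word_induction with
  | hw w =>
    rcases w with _ | ⟨c, w⟩
    · rw [wordBasis_nil, rho_one_apply, map_one, map_one]
    · rw [wordBasis_cons, rho_genX_mul, leftDer_one, map_mul, FreeEnveloping.counitHom_genX,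
        zero_mul]
      exact map_zero (rho K (wordBasis K w)).ofConv
  | h0 => rw [map_zero, map_zero]; rfl
  | ha x y hx hy => rw [map_add, map_add, ← hx, ← hy]; rfl
  | hs r x hx => rw [map_smul, map_smul, ← hx]; rfl

theorem evalTensor_genX_mul (c : ℕ+) (f g : FaaDiBruno K)
    (z : FreeEnveloping K ⊗[K] FreeEnveloping K) :
    evalTensor K f g (TensorProduct.map (rho K).toLinearMap (rho K).toLinearMap
        ((genX K c ⊗ₜ[K] 1 + 1 ⊗ₜ[K] genX K c) * z)) =
      evalTensor K (leftDer K c f) g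
          (TensorProduct.map (rho K).toLinearMap (rho K).toLinearMap z) +
        evalTensor K f (leftDer K c g)
          (TensorProduct.map (rho K).toLinearMap (rho K).toLinearMap z) := by
  induction z with
  | zero => simp
  | add x y hx hy => rw [mul_add, map_add, map_add, hx, hy]; simp only [map_add]; ring
  | tmul x y =>
    rw [add_mul, Algebra.TensorProduct.tmul_mul_tmul, Algebra.TensorProduct.tmul_mul_tmul,
      one_mul, one_mul, map_add, map_add]
    simp only [TensorProduct.map_tmul, AlgHom.toLinearMap_apply, evalTensor_tmul, rho_genX_mul]

theorem rho_apply_mul (x : FreeEnveloping K) (f g : FaaDiBruno K) :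
    rho K x (f * g) = evalTensor K f g
      (TensorProduct.map (rho K).toLinearMap (rho K).toLinearMap
        (FreeEnveloping.comulHom K x)) := by
  induction x using FreeEnveloping.word_induction generalizing f g with
  | hw w =>
    induction w generalizing f g with
    | nil =>
      rw [wordBasis_nil, rho_one_apply, map_one, map_mul, Algebra.TensorProduct.one_def,
        TensorProduct.map_tmul, evalTensor_tmul]
      exact congrArg₂ _ (rho_one_apply f).symm (rho_one_apply g).symm
    | cons c w ih =>
      rw [wordBasis_cons, rho_genX_mul, leftDer_mul, map_mul, FreeEnveloping.comulHom_genX,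
        evalTensor_genX_mul, ← ih, ← ih]
      exact map_add (rho K (wordBasis K w)).ofConv _ _
  | h0 => simp only [map_zero]; rfl
  | ha x y hx hy => simp only [map_add, ← hx, ← hy]; rfl
  | hs r x hx => simp only [map_smul, ← hx]; rfl

variable (K) in
/-- The transpose of `ρ` as a morphism of algebras: `δ_n ↦ Γ_n`. -/
def transposeHom : FaaDiBruno K →ₐ[K] ShuffleAlgebra K :=
  (evalHom K fun i => gamma K (i + 1)).comp (toDelta K).symm.toAlgHom

theorem transposeHom_toDelta (f : FaaDiBruno K) :
    transposeHom K (toDelta K f) = evalHom K (fun i => gamma K (i + 1)) f := by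
  rw [transposeHom, AlgHom.comp_apply]
  exact congrArg _ ((toDelta K).symm_apply_apply f)

theorem transposeHom_delta {n : ℕ} (hn : 1 ≤ n) : transposeHom K (delta K n) = gamma K n := by
  obtain ⟨m, hm⟩ := Nat.exists_eq_add_of_le' hn
  rw [hm, ← toDelta_a, transposeHom_toDelta, evalHom_a]

theorem removeLeft_transposeHom (c : ℕ+) (f : FaaDiBruno K) :
    removeLeft c (transposeHom K f) = transposeHom K (leftDer K c f) := by
  induction f using delta_induction with
  | hC r =>
    rw [leftDer_algebraMap, map_zero, AlgHom.commutes, Algebra.algebraMap_eq_smul_one, map_smul,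
      removeLeft_one, smul_zero]
  | hd n hn =>
    rw [transposeHom_delta hn, removeLeft_gamma, leftDer_delta c.pos hn]
    split_ifs with h1 h2
    · rw [map_smul, map_one]
    · rw [map_smul, transposeHom_delta (by omega)]
    · rw [map_zero]
  | ha f g hf hg => rw [map_add, map_add, hf, hg, map_add, map_add]
  | hm f g hf hg => rw [map_mul, removeLeft_mul, hf, hg, leftDer_mul, map_add, map_mul, map_mul]

theorem counit_transposeHom (f : FaaDiBruno K) :
    CoalgebraStruct.counit (R := K) (transposeHom K f) = counitHom K f := by
  change Bialgebra.counitAlgHom K (ShuffleAlgebra K) (transposeHom K f) = _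
  induction f using delta_induction with
  | hC r => simp only [AlgHom.commutes]
  | hd n hn =>
    rw [transposeHom_delta hn, counitHom_delta]
    refine (coord_gamma n []).trans (if_neg ?_)
    rw [weight_nil]; omega
  | ha f g hf hg => simp only [map_add, hf, hg]
  | hm f g hf hg => simp only [map_mul, hf, hg]

theorem coord_transposeHom (w : List ℕ+) (f : FaaDiBruno K) :
    (basis K).coord w (transposeHom K f) = rho K (wordBasis K w) f := by
  induction w generalizing f with
  | nil => rw [coord_nil, wordBasis_nil, rho_one_apply]; exact counit_transposeHom f
  | cons c w ih =>
    rw [← coord_removeLeft, removeLeft_transposeHom, ih, wordBasis_cons, rho_genX_mul]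

theorem coordTensor_map_transposeHom (v w : List ℕ+) (z : FaaDiBruno K ⊗[K] FaaDiBruno K) :
    coordTensor v w (Algebra.TensorProduct.map (transposeHom K) (transposeHom K) z) =
      LinearMap.mul' K K (TensorProduct.map (rho K (wordBasis K v)).ofConv
        (rho K (wordBasis K w)).ofConv z) := by
  induction z with
  | zero => simp
  | add x y hx hy => simp only [map_add, hx, hy]
  | tmul x y =>
    rw [Algebra.TensorProduct.map_tmul, coordTensor_tmul, coord_transposeHom, coord_transposeHom]
    rfl

variable (K) in
/-- The transpose of `ρ` as a morphism of bialgebras. -/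
def transpose : FaaDiBruno K →ₐc[K] ShuffleAlgebra K :=
  BialgHom.ofAlgHom (transposeHom K) (AlgHom.ext counit_transposeHom) <| by
    refine AlgHom.ext fun f => ext_coordTensor fun v w => ?_
    refine (coordTensor_map_transposeHom v w _).trans
      (Eq.trans ?_ (coordTensor_comul v w (transposeHom K f)).symm)
    rw [coord_transposeHom, wordBasis_append, map_mul]
    rfl

theorem pairing_transpose (f : FaaDiBruno K) (x : FreeEnveloping K) :
    pairing K (transpose K f) x = rho K x f := by
  induction x using FreeEnveloping.word_induction with
  | hw w => exact (pairing_wordBasis _ w).trans (coord_transposeHom w f)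
  | h0 => rw [map_zero, map_zero]; rfl
  | ha x y hx hy => rw [map_add, map_add, hx, hy]; rfl
  | hs r x hx => rw [map_smul, map_smul, hx]; rfl

end FaaDiBruno

section Injectivity

open ShuffleAlgebra MvPolynomial

variable {K : Type*} [Field K] [CharZero K]

/-- Removing the letter `i + 1` differentiates polynomials in `Γ_1, …, Γ_{i+1}` by `Γ_{i+1}`. -/
theorem removeLeft_aeval_gamma (i : ℕ) {p : MvPolynomial ℕ K}
    (hp : p ∈ supported K (Set.Iic i)) :
    removeLeft i.succPNat (aeval (fun j => gamma K (j + 1)) p) =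
      ((i + 2)! : K) • aeval (fun j => gamma K (j + 1)) (pderiv i p) := by
  rw [supported_eq_adjoin_X] at hp
  induction hp using Algebra.adjoin_induction with
  | mem x hx =>
    obtain ⟨j, hj, rfl⟩ := hx
    have hj : j ≤ i := hj
    rw [aeval_X, removeLeft_gamma, Nat.succPNat_coe]
    by_cases h : j = i
    · rw [if_pos (by omega), h, pderiv_X_self, map_one]
    · rw [if_neg (by omega), if_neg (by omega), pderiv_X_of_ne h, map_zero, smul_zero]
  | algebraMap r =>
    rw [AlgHom.commutes, Derivation.map_algebraMap, map_zero, smul_zero,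
      Algebra.algebraMap_eq_smul_one, map_smul, removeLeft_one, smul_zero]
  | add x y _ _ hx hy => simp only [map_add, hx, hy, smul_add]
  | mul x y _ _ hx hy =>
    rw [map_mul, removeLeft_mul, hx, hy, pderiv_mul, map_add, map_mul, map_mul, smul_add,
      smul_mul_assoc, mul_smul_comm]

theorem eq_zero_of_aeval_gamma_eq_zero (n : ℕ) {p : MvPolynomial ℕ K} (hn : p.totalDegree ≤ n)
    (hp : aeval (fun j => gamma K (j + 1)) p = 0) : p = 0 := by
  have hC : ∀ r : K, aeval (fun j => gamma K (j + 1)) (C r : MvPolynomial ℕ K) = 0 → r = 0 := by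
    intro r hr
    rw [← algebraMap_eq, AlgHom.commutes] at hr
    have h := congrArg (Bialgebra.counitAlgHom K (ShuffleAlgebra K)) hr
    rwa [AlgHom.commutes, map_zero] at h
  induction n using Nat.strong_induction_on generalizing p with | _ n ih => ?_
  by_contra hp0
  by_cases hv : p.vars = ∅
  · have h : p ∈ supported K (∅ : Set ℕ) := mem_supported.mpr (by simp [hv])
    rw [supported_empty] at h
    obtain ⟨r, rfl⟩ := Algebra.mem_bot.mp h
    exact hp0 (by rw [hC r hp, map_zero])
  · have hne := Finset.nonempty_iff_ne_empty.mpr hv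
    set i := p.vars.max' hne
    have hs : p ∈ supported K (Set.Iic i) :=
      mem_supported.mpr fun j hj => Finset.le_max' _ j hj
    have h := removeLeft_aeval_gamma i hs
    rw [hp, map_zero] at h
    have h1 : aeval (fun j => gamma K (j + 1)) (pderiv i p) = 0 :=
      (smul_eq_zero.mp h.symm).resolve_left (by exact_mod_cast Nat.factorial_ne_zero _)
    obtain ⟨d, hd, hid⟩ := (mem_vars_iff_mem_support i).mp (p.vars.max'_mem hne)
    have hdi : d i ≠ 0 := Finsupp.mem_support_iff.mp hid
    have h2 : pderiv i p ≠ 0 := by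
      intro h3
      have h4 := coeff_pderiv (i := i) p (d - Finsupp.single i 1)
      rw [h3, Finsupp.sub_add_single_one_cancel hdi, coeff_zero] at h4
      exact mul_ne_zero (mem_support_iff.mp hd) (Nat.cast_add_one_ne_zero _) h4.symm
    have h3 : ∀ m ∈ (pderiv i p).support, (m.sum fun _ e => e) + 1 ≤ n := by
      intro m hm
      rw [mem_support_iff, coeff_pderiv] at hm
      have h4 := (le_totalDegree (mem_support_iff.mpr (left_ne_zero_of_mul hm))).trans hn
      rwa [Finsupp.sum_add_index' (fun _ => rfl) (fun _ _ _ => rfl),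
        Finsupp.sum_single_index rfl] at h4
    rcases n with _ | n
    · obtain ⟨m, hm⟩ := support_nonempty.mpr h2
      exact absurd (h3 m hm) (by omega)
    · exact h2 (ih n (Nat.lt_succ_self n)
        (Finset.sup_le fun m hm => Nat.le_of_succ_le_succ (h3 m hm)) h1)

theorem FaaDiBruno.transposeHom_injective : Function.Injective (transposeHom K) := by
  rw [injective_iff_map_eq_zero]
  intro f hf
  obtain ⟨g, rfl⟩ := (toDelta K).surjective f
  rw [transposeHom_toDelta] at hf
  have hg : g = 0 := eq_zero_of_aeval_gamma_eq_zero _ le_rfl hf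
  rw [hg, map_zero]

end Injectivity

namespace ShuffleAlgebra

variable {K : Type*} [Field K]

variable (K) in
/-- The span of the words of weight `d`. -/
def homogeneous (d : ℕ) : Submodule K (ShuffleAlgebra K) :=
  Submodule.span K {x | ∃ w, weight w = d ∧ x = u K w}

theorem weight_of_mem_shuffles (v w : List ℕ+) :
    ∀ z ∈ shuffles v w, weight z = weight v + weight w := by
  induction v, w using shuffles.induct with
  | case1 w => intro z hz; rw [shuffles, List.mem_singleton] at hz; simp [hz]
  | case2 a v => intro z hz; rw [shuffles, List.mem_singleton] at hz; simp [hz]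
  | case3 a v b w h1 h2 =>
    intro z hz
    rw [shuffles, List.mem_append, List.mem_map, List.mem_map] at hz
    rcases hz with ⟨z, hz, rfl⟩ | ⟨z, hz, rfl⟩
    · rw [weight_cons, h1 z hz, weight_cons a, add_assoc]
    · rw [weight_cons, h2 z hz, weight_cons b, add_left_comm]

theorem mul_mem_homogeneous {d e : ℕ} {x y : ShuffleAlgebra K} (hx : x ∈ homogeneous K d)
    (hy : y ∈ homogeneous K e) : x * y ∈ homogeneous K (d + e) := by
  have h := Submodule.mul_mem_mul hx hy
  rw [homogeneous, homogeneous, Submodule.span_mul_span] at h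
  refine Submodule.span_le.mpr ?_ h
  rintro _ ⟨_, ⟨v, hv, rfl⟩, _, ⟨w, hw, rfl⟩, rfl⟩
  change u K v * u K w ∈ homogeneous K (d + e)
  rw [u_mul_u]
  refine list_sum_mem fun z hz => ?_
  obtain ⟨z, hz', rfl⟩ := List.mem_map.mp hz
  exact Submodule.subset_span ⟨z, by rw [weight_of_mem_shuffles v w z hz', hv, hw], rfl⟩

theorem exists_toWord_eq (w : List ℕ+) : ∃ c : Composition (weight w), c.toWord = w :=
  ⟨⟨w.map ((↑) : ℕ+ → ℕ), by simp, rfl⟩,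
    List.map_injective_iff.mpr PNat.coe_injective (map_toWord _)⟩

theorem weight_toWord {n : ℕ} (c : Composition n) : weight c.toWord = n := by
  rw [weight, map_toWord, c.blocks_sum]

theorem finite_weight_le (N : ℕ) : {w : List ℕ+ | weight w ≤ N}.Finite := by
  refine ((Set.finite_Iic N).biUnion fun n _ =>
    Set.finite_range (Composition.toWord : Composition n → List ℕ+)).subset fun w hw => ?_
  exact Set.mem_biUnion (show weight w ∈ Set.Iic N from hw) (exists_toWord_eq w)

theorem gamma_mem_homogeneous (n : ℕ) : gamma K n ∈ homogeneous K n :=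
  Submodule.smul_mem _ _ (sum_mem fun c _ => Submodule.smul_mem _ _
    (Submodule.subset_span ⟨_, weight_toWord c, rfl⟩))

theorem coord_eq_zero_of_mem_homogeneous {d : ℕ} {x : ShuffleAlgebra K} (hx : x ∈ homogeneous K d)
    {w : List ℕ+} (hw : weight w ≠ d) : (basis K).coord w x = 0 := by
  classical
  induction hx using Submodule.span_induction with
  | mem x h =>
    obtain ⟨v, hv, rfl⟩ := h
    rw [coord_u, if_neg]
    rintro rfl
    exact hw hv
  | zero => exact map_zero _
  | add x y _ _ hx hy => rw [map_add, hx, hy, add_zero]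
  | smul r x _ hx => rw [map_smul, hx, smul_zero]

theorem sum_coord_smul_u {d N : ℕ} (hd : d ≤ N) {x : ShuffleAlgebra K}
    (hx : x ∈ homogeneous K d) :
    ∑ w ∈ (finite_weight_le N).toFinset, (basis K).coord w x • u K w = x := by
  classical
  refine ext_coord fun v => ?_
  simp only [map_sum, map_smul, coord_u, smul_eq_mul, mul_ite, mul_one, mul_zero]
  rw [Finset.sum_ite_eq']
  split_ifs with h
  · rfl
  · refine (coord_eq_zero_of_mem_homogeneous hx fun hv => h ?_).symm
    rw [Set.Finite.mem_toFinset]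
    exact hv.trans_le hd

end ShuffleAlgebra

namespace FaaDiBruno

open ShuffleAlgebra

variable {K : Type*} [Field K]

variable (K) in
/-- The monomial with exponents `m`; the exponent of `a_{i+2}` is `m i`. -/
def monomial (m : ℕ →₀ ℕ) : FaaDiBruno K := (MvPolynomial.monomial m (1 : K) : MvPolynomial ℕ K)

theorem monomial_zero : monomial K 0 = 1 := rfl

theorem monomial_add (m m' : ℕ →₀ ℕ) : monomial K (m + m') = monomial K m * monomial K m' := by
  have h : (MvPolynomial.monomial (m + m') (1 : K) : MvPolynomial ℕ K) =
      MvPolynomial.monomial m 1 * MvPolynomial.monomial m' 1 := by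
    rw [MvPolynomial.monomial_mul, one_mul]
  exact h

theorem monomial_single_one (i : ℕ) : monomial K (Finsupp.single i 1) = a K (i + 2) := rfl

/-- Functionals agreeing on homogeneous polynomials are equal. -/
theorem functional_ext {b c : WithConv (FaaDiBruno K →ₗ[K] K)}
    (h : ∀ d, ∀ f ∈ homogeneous K d, b f = c f) : b = c := by
  refine WithConv.ext ((MvPolynomial.basisMonomials ℕ K).ext fun m => ?_)
  refine h (Finsupp.weight (fun i : ℕ => i + 1) m) _ ?_
  rw [MvPolynomial.coe_basisMonomials]
  exact MvPolynomial.isWeightedHomogeneous_monomial _ _ _ rfl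

variable [CharZero K]

theorem monomial_mem_deltaSpan (m : ℕ →₀ ℕ) :
    monomial K m ∈ deltaSpan K 0 (Finsupp.weight (fun i : ℕ => i + 1) m) := by
  induction m using Finsupp.induction_linear with
  | zero => rw [map_zero, monomial_zero]; exact one_mem_deltaSpan
  | add m m' h h' => rw [map_add, monomial_add]; exact mul_mem_deltaSpan (m := 0) (m' := 0) h h'
  | single i n =>
    rw [Finsupp.weight_single, smul_eq_mul]
    induction n with
    | zero => rw [Finsupp.single_zero, zero_mul, monomial_zero]; exact one_mem_deltaSpan
    | succ n ih =>
      rw [Finsupp.single_add, monomial_add, monomial_single_one, add_mul, one_mul]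
      exact mul_mem_deltaSpan (m := 0) (m' := 0) ih
        (deltaSpan_anti zero_le_one _ (a_mem_deltaSpan (n := i + 1) (by omega)))

theorem homogeneous_le_deltaSpan (d : ℕ) : homogeneous K d ≤ deltaSpan K 0 d := by
  intro f hf
  induction (hf : MvPolynomial.IsWeightedHomogeneous (fun i : ℕ => i + 1) f d) using
    MvPolynomial.IsWeightedHomogeneous.induction_on with
  | zero => exact zero_mem _
  | add p q hp hq h1 h2 => exact add_mem h1 h2
  | monomial m r hm =>
    have h : (MvPolynomial.monomial m r : MvPolynomial ℕ K) = r • monomial K m :=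
      (by rw [MvPolynomial.smul_monomial, smul_eq_mul, mul_one] :
        (MvPolynomial.monomial m r : MvPolynomial ℕ K) = r • MvPolynomial.monomial m 1)
    rw [h, ← hm]
    exact Submodule.smul_mem _ r (monomial_mem_deltaSpan m)

theorem transposeHom_mem_homogeneous {d : ℕ} {f : FaaDiBruno K} (hf : f ∈ homogeneous K d) :
    transposeHom K f ∈ ShuffleAlgebra.homogeneous K d := by
  have h := homogeneous_le_deltaSpan d hf
  clear hf
  induction h using Submodule.span_induction with
  | mem x hx =>
    obtain ⟨s, -, hs, rfl, rfl⟩ := hx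
    induction s using Multiset.induction_on with
    | empty =>
      rw [Multiset.map_zero, Multiset.prod_zero, map_one]
      exact Submodule.subset_span ⟨[], rfl, rfl⟩
    | cons i s ih =>
      rw [Multiset.map_cons, Multiset.prod_cons, map_mul, Multiset.sum_cons,
        transposeHom_delta (hs i (Multiset.mem_cons_self i s))]
      exact mul_mem_homogeneous (gamma_mem_homogeneous i)
        (ih fun j hj => hs j (Multiset.mem_cons_of_mem hj))
  | zero => rw [map_zero]; exact zero_mem _
  | add x y _ _ hx hy => rw [map_add]; exact add_mem hx hy
  | smul r x _ hx => rw [map_smul]; exact Submodule.smul_mem _ r hx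

theorem rho_wordBasis_eq_zero {d : ℕ} {f : FaaDiBruno K} (hf : f ∈ homogeneous K d)
    {w : List ℕ+} (hw : weight w ≠ d) : rho K (wordBasis K w) f = 0 := by
  rw [← coord_transposeHom]
  exact coord_eq_zero_of_mem_homogeneous (transposeHom_mem_homogeneous hf) hw

theorem rho_mem_gradedDual (x : FreeEnveloping K) : rho K x ∈ gradedDual K := by
  induction x using FreeEnveloping.word_induction with
  | hw w => exact ⟨weight w, fun d hd f hf => rho_wordBasis_eq_zero hf hd.ne⟩
  | h0 => exact ⟨0, fun d _ f _ => by rw [map_zero]; rfl⟩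
  | ha x y hx hy =>
    obtain ⟨N, hN⟩ := hx
    obtain ⟨M, hM⟩ := hy
    refine ⟨max N M, fun d hd f hf => ?_⟩
    have h : rho K (x + y) f = rho K x f + rho K y f := by rw [map_add]; rfl
    rw [h, hN d (lt_of_le_of_lt (le_max_left _ _) hd) f hf,
      hM d (lt_of_le_of_lt (le_max_right _ _) hd) f hf, add_zero]
  | hs r x hx =>
    obtain ⟨N, hN⟩ := hx
    refine ⟨N, fun d hd f hf => ?_⟩
    have h : rho K (r • x) f = r * rho K x f := by rw [map_smul]; rfl
    rw [h, hN d hd f hf, mul_zero]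

theorem exists_rho_eq {b : WithConv (FaaDiBruno K →ₗ[K] K)} (hb : b ∈ gradedDual K) :
    ∃ x, rho K x = b := by
  obtain ⟨N, hN⟩ := hb
  obtain ⟨σ, hσ⟩ := (transposeHom K).toLinearMap.exists_leftInverse_of_injective
    (LinearMap.ker_eq_bot.mpr transposeHom_injective)
  refine ⟨∑ w ∈ (finite_weight_le N).toFinset, b (σ (u K w)) • wordBasis K w,
    functional_ext fun d f hf => ?_⟩
  have h1 : rho K (∑ w ∈ (finite_weight_le N).toFinset, b (σ (u K w)) • wordBasis K w) f =
      ∑ w ∈ (finite_weight_le N).toFinset,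
        b (σ (u K w)) * (basis K).coord w (transposeHom K f) := by
    change evalAt K f _ = _
    rw [map_sum, map_sum]
    refine Finset.sum_congr rfl fun w _ => ?_
    rw [map_smul, map_smul, smul_eq_mul, coord_transposeHom]
    rfl
  have hτ := transposeHom_mem_homogeneous hf
  rw [h1]
  by_cases hd : d ≤ N
  · have h2 : f = σ (transposeHom K f) := (congrArg (fun g => g f) hσ).symm
    conv_rhs => rw [h2, ← sum_coord_smul_u hd hτ]
    change _ = b.ofConv (σ _)
    rw [map_sum, map_sum]
    refine Finset.sum_congr rfl fun w _ => ?_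
    rw [map_smul, map_smul, smul_eq_mul, mul_comm]
  · rw [hN d (not_le.mp hd) f hf]
    refine Finset.sum_eq_zero fun w hw => ?_
    rw [Set.Finite.mem_toFinset] at hw
    have hw : weight w ≤ N := hw
    rw [coord_eq_zero_of_mem_homogeneous hτ (by omega), mul_zero]

theorem range_rho : Set.range (rho K) = gradedDual K :=
  Set.Subset.antisymm (Set.range_subset_iff.mpr rho_mem_gradedDual) fun _ hb => exists_rho_eq hb

end FaaDiBruno

end

theorem mainTheorem2 (K : Type*) [Field K] [CharZero K] :
    -- the `δ_n`, `n ≥ 1`, are polynomial coordinates, and the bilinear part of `Δ δ_n` is `B(δ_n)`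
    (AlgebraicIndependent K (fun i : ℕ => FaaDiBruno.delta K (i + 1)) ∧
      Algebra.adjoin K (Set.range fun i : ℕ => FaaDiBruno.delta K (i + 1)) = ⊤) ∧
    (∀ n : ℕ, 1 ≤ n →
      CoalgebraStruct.comul (R := K) (FaaDiBruno.delta K n) -
        (FaaDiBruno.delta K n ⊗ₜ[K] 1 + 1 ⊗ₜ[K] FaaDiBruno.delta K n +
          ∑ i ∈ Finset.Icc 1 (n - 1),
            (n.choose (i - 1)) • (FaaDiBruno.delta K (n - i) ⊗ₜ[K] FaaDiBruno.delta K i)) ∈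
        FaaDiBruno.higherTerms K n) ∧
    -- `ρ` is a surjection of `U(A)` onto the graded dual, compatible with the coalgebra structures
    Set.range (FaaDiBruno.rho K) = FaaDiBruno.gradedDual K ∧
    (∀ (x : FreeEnveloping K) (f g : FaaDiBruno K),
      FaaDiBruno.rho K x (f * g) =
        FaaDiBruno.evalTensor K f g
          (TensorProduct.map (FaaDiBruno.rho K).toLinearMap (FaaDiBruno.rho K).toLinearMap
            (FreeEnveloping.comulHom K x))) ∧
    (∀ x : FreeEnveloping K, FaaDiBruno.rho K x 1 = FreeEnveloping.counitHom K x) ∧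
    -- its transpose is an injective Hopf map, with the stated values on the `δ_n`
    ∃ τ : FaaDiBruno K →ₐc[K] ShuffleAlgebra K,
      (∀ (f : FaaDiBruno K) (x : FreeEnveloping K),
        pairing K (τ f) x = FaaDiBruno.rho K x f) ∧
      Function.Injective τ ∧
      (∀ f : FaaDiBruno K, τ (HopfAlgebra.antipode K f) = HopfAlgebra.antipode K (τ f)) ∧
      ∀ n : ℕ, 1 ≤ n →
        τ (FaaDiBruno.delta K n) =
          (n ! : K) • ∑ c : Composition n,
            (wordCoeff c.blocks : K) • ShuffleAlgebra.u K c.toWord :=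
  ⟨⟨FaaDiBruno.algebraicIndependent_delta, FaaDiBruno.adjoin_delta⟩,
    fun _ => FaaDiBruno.comul_delta_sub_mem_higherTerms, FaaDiBruno.range_rho,
    FaaDiBruno.rho_apply_mul, FaaDiBruno.rho_apply_one,
    FaaDiBruno.transpose K, FaaDiBruno.pairing_transpose,
    FaaDiBruno.transposeHom_injective, BialgHom.apply_antipode _,
    fun _ => FaaDiBruno.transposeHom_delta⟩
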